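/- Let $M$ be a closed (compact, without boundary) smooth manifold of dimension $n$, let $\mathcal M$ be the set of smooth Riemannian metrics on $M$, with its Fréchet ($C^\infty$) topology, and fix a reference metric $g\in\mathcal M$; nullsets and "a.e." refer to the Riemannian measure $\mu_g$. (No orientation of $M$ is needed.) Let $d$ be the Riemannian distance function on $\mathcal M$ of the $L^2$ metric $(h,k)_{\tilde g}=\int_M \operatorname{tr}(\tilde g^{-1}h\,\tilde g^{-1}k)\,d\mu_{\tilde g}$, i.e. the infimum of the lengths of piecewise $C^1$ paths. For $x\in M$ let $\theta^g_x$ be the Riemannian distance function on the manifold of positive definite symmetric bilinear forms on $T_xM$ of the Riemannian metric $\langle h,k\rangle^0_a=\operatorname{tr}(a^{-1}h\,a^{-1}k)\det(g(x)^{-1}a)$. A measurable semimetric is a section $h$ of $S^2T^*M$ with Lebesgue measurable coefficients that is positive semidefinite at every point. It induces the measure $\mu_h$ given locally by $\sqrt{\det h}\,dx^1\cdots dx^n$; write $\operatorname{Vol}(Y,h)=\mu_h(Y)$. Its deflated set $X_h$ is the set of points where $h$ is not positive definite. Two measurable semimetrics $h_0,h_1$ are equivalent if $X_{h_0}$ and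 $X_{h_1}$ differ at most by a nullset and $h_0(x)=h_1(x)$ for a.e. $x\in M\setminus(X_{h_0}\cup X_{h_1})$. Let $\widehat{\mathcal M_m}$ be the set of equivalence classes and $\widehat{\mathcal M_f}\subset\widehat{\mathcal M_m}$ the set of classes all of whose representatives have finite total volume. The deflated set of a sequence $\{g_k\}\subset\mathcal M$ is $X_{\{g_k\}}=\{x\in M : \forall \delta>0\ \exists k,\ \det(g(x)^{-1}g_k(x))<\delta\}$. The sequence $\omega$-converges to $[g_\infty]\in\widehat{\mathcal M_m}$ if, for every representative $g_\infty$ of the class: (1) $\{g_k\}$ is $d$-Cauchy; (2) $X_{g_\infty}$ and $X_{\{g_k\}}$ differ at most by a nullset; (3) $g_k(x)\to g_\infty(x)$ for a.e. $x\in M\setminus X_{\{g_k\}}$; (4) $\sum_k d(g_k,g_{k+1})<\infty$. It $\omega$-converges to a measurable semimetric $g_\infty$ if it $\omega$-converges to $[g_\infty]$. A $d$-Cauchy sequence $\omega$-subconverges to $[g_\infty]$ if some subsequence of it $\omega$-converges to $[g_\infty]$. Theorem. (a) For every $d$-Cauchy sequence $\{g_k\}$ in $\mathcal M$ there are a subsequence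 $\{g_{k_l}\}$ and a measurable semimetric $g_\infty$ with $[g_\infty]\in\widehat{\mathcal M_f}$ such that $\{g_{k_l}\}$ $\omega$-converges to $[g_\infty]$, where $g_\infty$ is given explicitly as follows. At points $x$ where $\{g_{k_l}(x)\}$ is $\theta^g_x$-Cauchy, $g_\infty(x)=0$ if $x\in X_{\{g_{k_l}\}}$, and $g_\infty(x)=\lim_l g_{k_l}(x)$ (in particular this limit exists) if $x\notin X_{\{g_{k_l}\}}$. At points $x$ where $\{g_{k_l}(x)\}$ is not $\theta^g_x$-Cauchy, $g_\infty(x)=0$. (b) For every $d$-Cauchy sequence $\{g_k\}$ in $\mathcal M$ there is an element $[g_\infty]\in\widehat{\mathcal M_f}$ such that $\{g_k\}$ $\omega$-subconverges to $[g_\infty]$. (c) If a sequence $\{g_k\}$ in $\mathcal M$ $\omega$-converges to a measurable semimetric $g_\infty$, then $\operatorname{Vol}(Y,g_k)\to\operatorname{Vol}(Y,g_\infty)$ for every Lebesgue measurable $Y\subseteq M$. -/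

import Mathlib

open Set Filter Topology MeasureTheory
open scoped Manifold ContDiff ENNReal

namespace ManifoldOfMetrics

universe u

/-! ### Sections of `T*M ⊗ T*M`

`M` is a manifold of dimension `n`, modelled on `EuclideanSpace ℝ (Fin n)`, with its Borel
σ-algebra. Compactness is only needed from the volume measures on. -/

section Tensors

variable (n : ℕ) (M : Type u) [TopologicalSpace M] [ChartedSpace (EuclideanSpace ℝ (Fin n)) M]

/-- Bilinear forms on the tangent space at `x`. -/
abbrev TwoForm (x : M) : Type :=
  TangentSpace (𝓡 n) x →L[ℝ] TangentSpace (𝓡 n) x →L[ℝ] ℝ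

/-- A (not necessarily continuous or symmetric) `(0,2)`-tensor field on `M`. -/
abbrev TensorField : Type u := (x : M) → TwoForm n M x

/-- A smooth Riemannian metric on `M`. -/
abbrev SmoothMetric [IsManifold (𝓡 n) ∞ M] : Type u :=
  Bundle.ContMDiffRiemannianMetric (𝓡 n) ∞ (EuclideanSpace ℝ (Fin n))
    (fun x : M => TangentSpace (𝓡 n) x)

/-- A smooth symmetric `(0,2)`-tensor field on `M`, that is, a smooth section of `S²T*M`. -/
structure SmoothSymTensor [IsManifold (𝓡 n) ∞ M] where
  toFun : TensorField n M
  symm : ∀ (x : M) (v w : TangentSpace (𝓡 n) x), toFun x v w = toFun x w v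
  contMDiff : ContMDiff (𝓡 n)
    ((𝓡 n).prod 𝓘(ℝ, EuclideanSpace ℝ (Fin n) →L[ℝ] EuclideanSpace ℝ (Fin n) →L[ℝ] ℝ)) ∞
    (fun x : M => Bundle.TotalSpace.mk'
      (EuclideanSpace ℝ (Fin n) →L[ℝ] EuclideanSpace ℝ (Fin n) →L[ℝ] ℝ)
      (E := fun x : M => TwoForm n M x) x (toFun x))

variable {n M}
variable [IsManifold (𝓡 n) ∞ M]

/-- The coordinate vector `∂/∂xⁱ` at `x` of the chart around `c` (for `x` in the domain of this
chart): the image of the `i`-th standard basis vector under the inverse of the trivialization of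
`TM` given by the chart around `c`. -/
noncomputable def coordVec (c x : M) (i : Fin n) : TangentSpace (𝓡 n) x :=
  (trivializationAt (EuclideanSpace ℝ (Fin n)) (fun y : M => TangentSpace (𝓡 n) y) c).symmL ℝ x
    (EuclideanSpace.single i (1 : ℝ))

/-- The matrix `(B(∂ᵢ, ∂ⱼ))ᵢⱼ` of a bilinear form `B` on `T_xM` in the chart around `c`. -/
noncomputable def gramIn (c : M) {x : M} (B : TwoForm n M x) : Matrix (Fin n) (Fin n) ℝ :=
  Matrix.of fun i j => B (coordVec c x i) (coordVec c x j)

/-- The coefficient `h_{ij}` of `h` in the chart around `c`, as a function on the image of the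
chart. (Outside the image of the chart its values are irrelevant.) -/
noncomputable def coeff (h : TensorField n M) (c : M) (i j : Fin n) :
    EuclideanSpace ℝ (Fin n) → ℝ :=
  fun y => gramIn c (h ((chartAt (EuclideanSpace ℝ (Fin n)) c).symm y)) i j

/-- Convergence in the `C^∞` (Fréchet) topology: in every chart, all partial derivatives of all
coefficients converge uniformly on compact subsets of the image of the chart. -/
def SmoothTendsto {ι : Type*} (F : ι → TensorField n M) (l : Filter ι) (h : TensorField n M) :
    Prop :=
  ∀ (c : M) (i j : Fin n) (k : ℕ) (K : Set (EuclideanSpace ℝ (Fin n))), IsCompact K →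
    K ⊆ (chartAt (EuclideanSpace ℝ (Fin n)) c).target →
    TendstoUniformlyOn (fun a => iteratedFDeriv ℝ k (coeff (F a) c i j))
      (iteratedFDeriv ℝ k (coeff h c i j)) l K

/-- `E ⊆ M` is Lebesgue measurable if its image in every chart is a Lebesgue measurable subset of
`ℝⁿ` (a set that is null-measurable for the Borel measure `volume`). -/
def IsLebesgueMeasurable (n : ℕ) {M : Type u} [TopologicalSpace M]
    [ChartedSpace (EuclideanSpace ℝ (Fin n)) M] (E : Set M) : Prop :=
  ∀ c : M, NullMeasurableSet (chartAt (EuclideanSpace ℝ (Fin n)) c ''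
    (E ∩ (chartAt (EuclideanSpace ℝ (Fin n)) c).source)) volume

variable (n M) in
/-- A measurable semimetric on `M`: a section of `S²T*M` that is positive semidefinite at every
point and has Lebesgue measurable coefficients in every chart. -/
structure MeasurableSemimetric where
  toFun : TensorField n M
  symm : ∀ (x : M) (v w : TangentSpace (𝓡 n) x), toFun x v w = toFun x w v
  nonneg : ∀ (x : M) (v : TangentSpace (𝓡 n) x), 0 ≤ toFun x v v
  measurable : ∀ (c : M) (i j : Fin n), NullMeasurable (coeff toFun c i j)
    (volume.restrict (chartAt (EuclideanSpace ℝ (Fin n)) c).target)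

/-- A bilinear form is positive definite. -/
def IsPosDef {x : M} (B : TwoForm n M x) : Prop :=
  ∀ v : TangentSpace (𝓡 n) x, v ≠ 0 → 0 < B v v

/-- The deflated set of a semimetric: the points at which it is not positive definite. -/
def deflatedSet (h : TensorField n M) : Set M := {x | ¬ IsPosDef (h x)}

end Tensors

/-! ### Coordinates and volume -/

section Volume

/-- A finite partition of `M` into Borel sets each of which lies in the domain of a chart: `x` lies
in the piece number `index x`, and this piece lies in the domain of the chart around
`center (index x)`. -/
structure FiniteChartPartition (n : ℕ) (M : Type u) [TopologicalSpace M]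
    [ChartedSpace (EuclideanSpace ℝ (Fin n)) M] [MeasurableSpace M] where
  card : ℕ
  center : Fin card → M
  index : M → Fin card
  measurableSet_piece : ∀ k, MeasurableSet {x | index x = k}
  mem_source : ∀ x, x ∈ (chartAt (EuclideanSpace ℝ (Fin n)) (center (index x))).source

theorem nonempty_finiteChartPartition (n : ℕ) (M : Type u) [TopologicalSpace M]
    [ChartedSpace (EuclideanSpace ℝ (Fin n)) M] [MeasurableSpace M] [BorelSpace M]
    [CompactSpace M] : Nonempty (FiniteChartPartition n M) := by
  classical
  obtain ⟨t, ht⟩ := isCompact_univ.elim_finite_subcover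
    (fun c : M => (chartAt (EuclideanSpace ℝ (Fin n)) c).source)
    (fun c => (chartAt (EuclideanSpace ℝ (Fin n)) c).open_source)
    (fun x _ => mem_iUnion.2 ⟨x, mem_chart_source _ x⟩)
  let p : Fin t.card → M := fun k => (t.equivFin.symm k : M)
  have hp : ∀ x : M, ∃ k, x ∈ (chartAt (EuclideanSpace ℝ (Fin n)) (p k)).source := by
    intro x
    obtain ⟨c, hc, hx⟩ := mem_iUnion₂.1 (ht (mem_univ x))
    exact ⟨t.equivFin ⟨c, hc⟩, by simpa [p] using hx⟩
  let s : M → Finset (Fin t.card) := fun x =>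
    Finset.univ.filter fun k => x ∈ (chartAt (EuclideanSpace ℝ (Fin n)) (p k)).source
  have hs : ∀ x, (s x).Nonempty := fun x => by
    obtain ⟨k, hk⟩ := hp x
    exact ⟨k, by simpa [s] using hk⟩
  have hmem : ∀ x, x ∈ (chartAt (EuclideanSpace ℝ (Fin n)) (p ((s x).min' (hs x)))).source :=
    fun x => (Finset.mem_filter.1 ((s x).min'_mem (hs x))).2
  refine ⟨⟨t.card, p, fun x => (s x).min' (hs x), fun k => ?_, hmem⟩⟩
  have : {x | (s x).min' (hs x) = k} =
      (chartAt (EuclideanSpace ℝ (Fin n)) (p k)).source \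
        ⋃ j : {j : Fin t.card // j < k}, (chartAt (EuclideanSpace ℝ (Fin n)) (p j)).source := by
    ext x
    simp only [mem_ofPred_eq, Set.mem_sdiff, mem_iUnion, not_exists]
    constructor
    · rintro rfl
      refine ⟨hmem x, fun j hj => ?_⟩
      exact absurd ((s x).min'_le j (by simpa [s] using hj)) (not_le.2 j.2)
    · rintro ⟨h1, h2⟩
      refine le_antisymm ((s x).min'_le k (by simpa [s] using h1)) ?_
      by_contra hlt
      exact h2 ⟨_, not_le.1 hlt⟩ (hmem x)
  rw [this]
  exact ((chartAt (EuclideanSpace ℝ (Fin n)) (p k)).open_source.measurableSet).diff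
    (MeasurableSet.iUnion fun j =>
      (chartAt (EuclideanSpace ℝ (Fin n)) (p j)).open_source.measurableSet)

variable {n : ℕ} {M : Type u} [TopologicalSpace M] [ChartedSpace (EuclideanSpace ℝ (Fin n)) M]
  [IsManifold (𝓡 n) ∞ M] [MeasurableSpace M] [BorelSpace M] [CompactSpace M]

variable (n M) in
/-- A fixed finite atlas of coordinates, together with a choice of one of its charts at each point.
The volume measures, `g`-traces and relative determinants below are computed in it; none of them
depends on this choice. -/
noncomputable def coords : FiniteChartPartition n M :=
  Classical.choice (nonempty_finiteChartPartition n M)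

/-- The matrix of `B` in the chart that `coords` assigns to `x`. -/
noncomputable def gram {x : M} (B : TwoForm n M x) : Matrix (Fin n) (Fin n) ℝ :=
  gramIn ((coords n M).center ((coords n M).index x)) B

variable (n M) in
/-- The measure `dx¹ ⋯ dxⁿ` on `M`, taken on each piece of the partition `coords` in the
coordinates of its chart. -/
noncomputable def coordMeasure : Measure M :=
  Measure.sum fun k : Fin (coords n M).card =>
    ((volume.restrict
      (chartAt (EuclideanSpace ℝ (Fin n)) ((coords n M).center k)).target).map
      (chartAt (EuclideanSpace ℝ (Fin n)) ((coords n M).center k)).symm).restrict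
      {x | (coords n M).index x = k}

/-- The measure `μ_h` induced by a semimetric `h`: locally, `dμ_h = √(det h) dx¹ ⋯ dxⁿ`.
On a Lebesgue measurable set which is not Borel, a Mathlib measure takes the value of its
completion. -/
noncomputable def vol (h : TensorField n M) : Measure M :=
  (coordMeasure n M).withDensity fun x => ENNReal.ofReal (Real.sqrt (gram (h x)).det)

/-- `tr_a(h k) = tr(a⁻¹ h a⁻¹ k)` on `T_xM`, for a positive definite `a`. -/
noncomputable def trProd {x : M} (a h k : TwoForm n M x) : ℝ :=
  ((gram a)⁻¹ * gram h * (gram a)⁻¹ * gram k).trace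

/-- `det A`, where `A = g⁻¹ a` is the endomorphism of `T_xM` obtained from `a` by raising an index
with `g`. -/
noncomputable def relDet {x : M} (g a : TwoForm n M x) : ℝ :=
  ((gram g)⁻¹ * gram a).det

end Volume

section Metrics

variable {n : ℕ} {M : Type u} [TopologicalSpace M] [ChartedSpace (EuclideanSpace ℝ (Fin n)) M]
  [IsManifold (𝓡 n) ∞ M] [MeasurableSpace M] [BorelSpace M] [CompactSpace M]

/-! ### The `L²` metric on the manifold of metrics and its distance function -/

/-- The norm `‖h‖_g = (∫_M tr_g(h²) dμ_g)^{1/2}` of the `L²` metric. -/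
noncomputable def l2Norm (g : SmoothMetric n M) (h : TensorField n M) : ℝ≥0∞ :=
  (∫⁻ x, ENNReal.ofReal (trProd (g.inner x) (h x) (h x)) ∂(vol g.inner)) ^ (1 / 2 : ℝ)

/-- A piecewise `C¹` path from `g₀` to `g₁` in the Fréchet manifold of smooth metrics. It is defined
on `[t 0, t m]`, where `m = pieces`, and on each `[t i, t (i+1)]`, `i < m`, it is `C¹` with
derivative `vel i`, with respect to the `C^∞` topology. (At the ends of each of these intervals the
derivative is one-sided; continuity of the path follows.) -/
structure MetricPath (g₀ g₁ : SmoothMetric n M) where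
  pieces : ℕ
  t : ℕ → ℝ
  monotone : Monotone t
  curve : ℝ → SmoothMetric n M
  vel : ℕ → ℝ → SmoothSymTensor n M
  source_eq : curve (t 0) = g₀
  target_eq : curve (t pieces) = g₁
  hasDeriv : ∀ i < pieces, ∀ s ∈ Icc (t i) (t (i + 1)),
    SmoothTendsto (fun r x => (r - s)⁻¹ • ((curve r).inner x - (curve s).inner x))
      (𝓝[Icc (t i) (t (i + 1)) \ {s}] s) (vel i s).toFun
  continuous_vel : ∀ i < pieces, ∀ s ∈ Icc (t i) (t (i + 1)),
    SmoothTendsto (fun r => (vel i r).toFun) (𝓝[Icc (t i) (t (i + 1))] s) (vel i s).toFun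

/-- The length of a path with respect to the `L²` metric. -/
noncomputable def MetricPath.length {g₀ g₁ : SmoothMetric n M} (γ : MetricPath g₀ g₁) : ℝ≥0∞ :=
  ∑ i ∈ Finset.range γ.pieces,
    ∫⁻ s in Icc (γ.t i) (γ.t (i + 1)), l2Norm (γ.curve s) (γ.vel i s).toFun

/-- The Riemannian distance function `d` of the `L²` metric: the infimum of the lengths of
piecewise `C¹` paths. -/
noncomputable def l2Dist (g₀ g₁ : SmoothMetric n M) : ℝ≥0∞ :=
  ⨅ γ : MetricPath g₀ g₁, γ.length

/-- `d`-Cauchy sequences of smooth metrics. -/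
def IsL2Cauchy (g : ℕ → SmoothMetric n M) : Prop :=
  ∀ ε : ℝ≥0∞, 0 < ε → ∃ N : ℕ, ∀ k ≥ N, ∀ l ≥ N, l2Dist (g k) (g l) < ε

/-! ### The metric `θ^g_x` on the positive definite forms on `T_xM` -/

/-- A piecewise `C¹` path from `a₀` to `a₁` in the manifold of positive definite symmetric bilinear
forms on `T_xM`. Differentiability and continuity in this finite-dimensional space are expressed
through the evaluations at pairs of vectors. -/
structure FiberPath {x : M} (a₀ a₁ : TwoForm n M x) where
  pieces : ℕ
  t : ℕ → ℝ
  monotone : Monotone t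
  curve : ℝ → TwoForm n M x
  vel : ℕ → ℝ → TwoForm n M x
  source_eq : curve (t 0) = a₀
  target_eq : curve (t pieces) = a₁
  symm : ∀ s ∈ Icc (t 0) (t pieces), ∀ v w, curve s v w = curve s w v
  posDef : ∀ s ∈ Icc (t 0) (t pieces), IsPosDef (curve s)
  hasDeriv : ∀ i < pieces, ∀ s ∈ Icc (t i) (t (i + 1)), ∀ v w,
    HasDerivWithinAt (fun r => curve r v w) (vel i s v w) (Icc (t i) (t (i + 1))) s
  continuous_vel : ∀ i < pieces, ∀ v w,
    ContinuousOn (fun r => vel i r v w) (Icc (t i) (t (i + 1)))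

/-- The length of a path with respect to the Riemannian metric
`⟨h, k⟩⁰_a = tr_a(h k) det(g⁻¹ a)`. -/
noncomputable def FiberPath.length {x : M} (g : TwoForm n M x) {a₀ a₁ : TwoForm n M x}
    (γ : FiberPath a₀ a₁) : ℝ≥0∞ :=
  ∑ i ∈ Finset.range γ.pieces, ∫⁻ s in Icc (γ.t i) (γ.t (i + 1)),
    ENNReal.ofReal (Real.sqrt (trProd (γ.curve s) (γ.vel i s) (γ.vel i s) * relDet g (γ.curve s)))

/-- The Riemannian distance function `θ^g_x`. -/
noncomputable def thetaDist {x : M} (g a₀ a₁ : TwoForm n M x) : ℝ≥0∞ :=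
  ⨅ γ : FiberPath a₀ a₁, γ.length g

/-- The sequence `(g_k(x))` is `θ^g_x`-Cauchy. -/
def IsThetaCauchyAt (g : SmoothMetric n M) (gs : ℕ → SmoothMetric n M) (x : M) : Prop :=
  ∀ ε : ℝ≥0∞, 0 < ε → ∃ N : ℕ, ∀ k ≥ N, ∀ l ≥ N,
    thetaDist (g.inner x) ((gs k).inner x) ((gs l).inner x) < ε

/-! ### Measurable semimetrics up to equivalence, and `ω`-convergence -/

/-- The deflated set `{x | ∀ δ > 0, ∃ k, det G_k(x) < δ}` of a sequence of metrics. -/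
def seqDeflatedSet (g : SmoothMetric n M) (gs : ℕ → SmoothMetric n M) : Set M :=
  {x | ∀ δ : ℝ, 0 < δ → ∃ k, relDet (g.inner x) ((gs k).inner x) < δ}

/-- Two semimetrics are equivalent if their deflated sets differ at most by a `μ_g`-nullset and they
agree almost everywhere off the union of their deflated sets. -/
def SemimetricEquiv (g : SmoothMetric n M) (h₀ h₁ : MeasurableSemimetric n M) : Prop :=
  vol g.inner (symmDiff (deflatedSet h₀.toFun) (deflatedSet h₁.toFun)) = 0 ∧
    ∀ᵐ x ∂(vol g.inner), x ∉ deflatedSet h₀.toFun ∪ deflatedSet h₁.toFun →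
      h₀.toFun x = h₁.toFun x

theorem semimetricEquiv_equivalence (g : SmoothMetric n M) :
    Equivalence (SemimetricEquiv g) where
  refl h := ⟨by simp, by simp⟩
  symm := by
    rintro h₀ h₁ ⟨hs, ha⟩
    refine ⟨by rwa [symmDiff_comm], ?_⟩
    filter_upwards [ha] with x hx hn
    exact (hx (by rwa [union_comm])).symm
  trans := by
    rintro h₀ h₁ h₂ ⟨hs, ha⟩ ⟨hs', ha'⟩
    refine ⟨measure_mono_null (symmDiff_triangle _ (deflatedSet h₁.toFun) _)
      (measure_union_null hs hs'), ?_⟩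
    have hs1 := measure_eq_zero_iff_ae_notMem.1 hs
    filter_upwards [ha, ha', hs1] with x hx hx' hx1 hn
    simp only [mem_union, not_or, mem_symmDiff, not_and, not_not] at hn hx hx' hx1
    have h1 : x ∉ deflatedSet h₁.toFun := fun h => hn.1 (hx1.2 h)
    exact (hx ⟨hn.1, h1⟩).trans (hx' ⟨h1, hn.2⟩)

/-- The equivalence of measurable semimetrics (nullsets are those of the reference metric `g`). -/
def semimetricSetoid (g : SmoothMetric n M) : Setoid (MeasurableSemimetric n M) :=
  ⟨SemimetricEquiv g, semimetricEquiv_equivalence g⟩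

/-- Equivalence classes of measurable semimetrics. -/
abbrev SemimetricClass (g : SmoothMetric n M) : Type u := Quotient (semimetricSetoid g)

/-- The equivalence class of a measurable semimetric. -/
def toClass (g : SmoothMetric n M) (h : MeasurableSemimetric n M) : SemimetricClass g :=
  Quotient.mk (semimetricSetoid g) h

/-- A semimetric has finite volume. -/
def HasFiniteVolume (h : MeasurableSemimetric n M) : Prop := vol h.toFun univ < ⊤

/-- The equivalence classes all of whose representatives have finite volume. -/
def finiteVolumeClasses (g : SmoothMetric n M) : Set (SemimetricClass g) :=
  {C | ∀ h : MeasurableSemimetric n M, toClass g h = C → HasFiniteVolume h}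

/-- The sequence `gs` `ω`-converges to the class `C`. -/
def OmegaConverges (g : SmoothMetric n M) (gs : ℕ → SmoothMetric n M) (C : SemimetricClass g) :
    Prop :=
  ∀ h : MeasurableSemimetric n M, toClass g h = C →
    IsL2Cauchy gs ∧
    vol g.inner (symmDiff (deflatedSet h.toFun) (seqDeflatedSet g gs)) = 0 ∧
    (∀ᵐ x ∂(vol g.inner), x ∉ seqDeflatedSet g gs →
      Tendsto (fun k => (gs k).inner x) atTop (𝓝 (h.toFun x))) ∧
    ∑' k, l2Dist (gs k) (gs (k + 1)) < ⊤

/-- The Cauchy sequence `gs` `ω`-subconverges to `C`: some subsequence `ω`-converges to `C`. -/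
def OmegaSubconverges (g : SmoothMetric n M) (gs : ℕ → SmoothMetric n M)
    (C : SemimetricClass g) : Prop :=
  IsL2Cauchy gs ∧ ∃ φ : ℕ → ℕ, StrictMono φ ∧ OmegaConverges g (gs ∘ φ) C

/-- `h` is the explicit limit of `gs`: at points where `gs` is `θ^g_x`-Cauchy, it is zero on the
deflated set of `gs` and the pointwise limit of `gs` off it; at all other points it is zero. -/
def IsExplicitLimit (g : SmoothMetric n M) (gs : ℕ → SmoothMetric n M)
    (h : MeasurableSemimetric n M) : Prop :=
  ∀ x : M,
    (IsThetaCauchyAt g gs x → x ∈ seqDeflatedSet g gs → h.toFun x = 0) ∧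
    (IsThetaCauchyAt g gs x → x ∉ seqDeflatedSet g gs →
      Tendsto (fun k => (gs k).inner x) atTop (𝓝 (h.toFun x))) ∧
    (¬ IsThetaCauchyAt g gs x → h.toFun x = 0)

end Metrics

end ManifoldOfMetrics

namespace ManifoldOfMetrics

universe u

set_option linter.unusedSectionVars false

/-! Everything is reduced to one nonnegative function of the point. A path of metrics, evaluated at
`x`, is a path `a` of positive definite forms with velocity `h`. Its amplitude at `x` is the
integral over the parameter of `√(tr_a(h²) √det a)`, with `det` taken in coordinates. The squared
integrand, integrated over `M` against coordinate measure, is the squared `L²` norm of `h`.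
Minkowski's integral inequality therefore bounds the `L²(M)` norm of the amplitude by the length of
the path (`MetricPath.lintegral_amplitude_sq_le`).

The amplitude controls two things at each point. By Jacobi's formula and Cauchy–Schwarz, `(det
a)^{1/4}` changes by at most `√n/4` times the amplitude. The speed for `θ` is the amplitude
integrand times `(det a)^{1/4} / √det g`, so the `θ`-length is bounded by the amplitude and the
initial fourth root (`FiberPath.length_mul_sqrt_det_le`).

If consecutive distances are summable, near-minimizing paths have amplitudes whose sum `S` lies in
`L²(M)` (`exists_paths`), hence is finite almost everywhere. Where `S` is finite, the sequence is
`θ`-Cauchy and the fourth roots of the determinants converge. At such a point two cases arise. If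
the determinants are bounded below, short `θ`-paths stay away from degenerate forms and along them
`log a(v,v)` varies at most by a multiple of the `θ`-length, so the forms converge
(`exists_tendsto_of_thetaCauchy`). Otherwise the infimum of the determinants is zero, and their
limit, which exists, must be zero.

Thus the volume densities converge almost everywhere to that of the limit, with value zero on the
deflated set. They are dominated by `(det(g_0)^{1/4} + (√n/4) S)²`, which is integrable; dominated
convergence gives both finiteness and convergence of the volumes (`tendsto_vol`). A general Cauchy
sequence is first thinned out to make the consecutive distances summable. -/

open Matrix in
/-- Jacobi's formula for the derivative of a determinant. -/
theorem hasDerivWithinAt_det {ι : Type*} [Fintype ι] [DecidableEq ι] {A : ℝ → Matrix ι ι ℝ}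
    {H : Matrix ι ι ℝ} {s : Set ℝ} {t : ℝ}
    (h : ∀ i j, HasDerivWithinAt (fun r => A r i j) (H i j) s t) :
    HasDerivWithinAt (fun r => (A r).det) ((A t).adjugate * H).trace s t := by
  have h1 : HasDerivWithinAt (fun r => ∑ σ : Equiv.Perm ι,
      ((Equiv.Perm.sign σ : ℤ) : ℝ) * ∏ i, A r (σ i) i)
      (∑ σ : Equiv.Perm ι, ((Equiv.Perm.sign σ : ℤ) : ℝ) *
        ∑ j, (∏ i ∈ Finset.univ.erase j, A t (σ i) i) • H (σ j) j) s t :=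
    HasDerivWithinAt.fun_sum fun σ _ =>
      (HasDerivWithinAt.fun_finsetProd fun i _ => h (σ i) i).const_mul _
  have h2 : (fun r => (A r).det) = fun r => ∑ σ : Equiv.Perm ι,
      ((Equiv.Perm.sign σ : ℤ) : ℝ) * ∏ i, A r (σ i) i := by
    funext r
    exact det_apply' _
  rw [h2]
  convert h1 using 1
  -- Cramer's rule: the diagonal entries of `adj A * H` are the determinants with one column
  -- replaced, which are the terms of the product rule.
  have h3 : ∀ j, ((A t).adjugate * H) j j = ((A t).updateCol j (H.col j)).det := by
    intro j
    rw [← cramer_apply, cramer_eq_adjugate_mulVec]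
    rfl
  simp only [trace, diag_apply, h3, det_apply']
  rw [Finset.sum_comm]
  refine Finset.sum_congr rfl fun σ _ => ?_
  rw [Finset.mul_sum]
  refine Finset.sum_congr rfl fun j _ => ?_
  congr 1
  rw [← Finset.mul_prod_erase _ _ (Finset.mem_univ j), smul_eq_mul, mul_comm]
  congr 1
  · refine Finset.prod_congr rfl fun i hi => ?_
    rw [updateCol_ne (Finset.ne_of_mem_erase hi)]
  · simp

/-! ### Trace inequalities and derivatives of powers of the determinant -/

section Inequalities

open Matrix

variable {ι : Type*} [Fintype ι] [DecidableEq ι] {A H : Matrix ι ι ℝ}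

open scoped MatrixOrder in
theorem exists_factor_of_posDef (hA : A.PosDef) : ∃ B : Matrix ι ι ℝ, IsUnit B ∧ A = Bᵀ * B := by
  obtain ⟨B, rfl⟩ := CStarAlgebra.nonneg_iff_eq_star_mul_self.mp hA.posSemidef.nonneg
  refine ⟨B, ?_, by simp [Matrix.star_eq_conjTranspose]⟩
  rw [Matrix.isUnit_iff_isUnit_det, isUnit_iff_ne_zero]
  intro h
  have := hA.det_pos
  simp [h] at this

/-- In an orthonormal frame for `A`, a symmetric form `H` is given by a symmetric matrix `K`. -/
theorem exists_normal_form (hA : A.PosDef) (hH : Hᵀ = H) : ∃ B K : Matrix ι ι ℝ,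
    A = Bᵀ * B ∧ H = Bᵀ * K * B ∧ Kᵀ = K ∧ (A⁻¹ * H).trace = K.trace ∧
      (A⁻¹ * H * A⁻¹ * H).trace = ∑ i, ∑ j, K i j ^ 2 := by
  obtain ⟨B, hB, rfl⟩ := exists_factor_of_posDef hA
  have hd : IsUnit B.det := (Matrix.isUnit_iff_isUnit_det B).1 hB
  have hdt : IsUnit Bᵀ.det := by rwa [Matrix.det_transpose]
  -- `A⁻¹H` is similar to `K = B⁻ᵀHB⁻¹`, so traces of its powers are those of `K`.
  have e : (Bᵀ * B)⁻¹ * H = B⁻¹ * ((Bᵀ)⁻¹ * H * B⁻¹) * B := by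
    rw [Matrix.mul_inv_rev]
    simp only [Matrix.mul_assoc, Matrix.nonsing_inv_mul _ hd, Matrix.mul_one]
  have hK : ((Bᵀ)⁻¹ * H * B⁻¹)ᵀ = (Bᵀ)⁻¹ * H * B⁻¹ := by
    simp [Matrix.transpose_mul, Matrix.transpose_nonsing_inv, hH, Matrix.mul_assoc]
  refine ⟨B, (Bᵀ)⁻¹ * H * B⁻¹, rfl, ?_, hK, ?_, ?_⟩
  · simp only [Matrix.mul_assoc, Matrix.nonsing_inv_mul _ hd, Matrix.mul_one]
    rw [Matrix.mul_nonsing_inv_cancel_left _ _ hdt]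
  · rw [e, Matrix.trace_mul_comm, ← Matrix.mul_assoc, Matrix.mul_nonsing_inv _ hd, Matrix.one_mul]
  · have e2 : (Bᵀ * B)⁻¹ * H * (Bᵀ * B)⁻¹ * H =
        B⁻¹ * ((Bᵀ)⁻¹ * H * B⁻¹ * ((Bᵀ)⁻¹ * H * B⁻¹)) * B := by
      rw [Matrix.mul_assoc ((Bᵀ * B)⁻¹ * H), e]
      generalize (Bᵀ)⁻¹ * H * B⁻¹ = K
      calc B⁻¹ * K * B * (B⁻¹ * K * B) = B⁻¹ * K * (B * B⁻¹) * K * B := by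
            simp only [Matrix.mul_assoc]
        _ = _ := by rw [Matrix.mul_nonsing_inv _ hd]; simp only [Matrix.mul_assoc, Matrix.one_mul]
    rw [e2, Matrix.trace_mul_comm, ← Matrix.mul_assoc, Matrix.mul_nonsing_inv _ hd, Matrix.one_mul]
    generalize (Bᵀ)⁻¹ * H * B⁻¹ = K at hK ⊢
    simp only [Matrix.trace, Matrix.diag_apply, Matrix.mul_apply]
    refine Finset.sum_congr rfl fun i _ => Finset.sum_congr rfl fun j _ => ?_
    have : K j i = K i j := congrFun (congrFun hK i) j
    rw [this, sq]

theorem trace_sq_nonneg (hA : A.PosDef) (hH : Hᵀ = H) : 0 ≤ (A⁻¹ * H * A⁻¹ * H).trace := by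
  obtain ⟨B, K, -, -, -, -, h⟩ := exists_normal_form hA hH
  rw [h]
  positivity

/-- Cauchy–Schwarz on the diagonal of the normal form `K`, after which the off-diagonal squares are
added. -/
theorem sq_trace_le (hA : A.PosDef) (hH : Hᵀ = H) :
    (A⁻¹ * H).trace ^ 2 ≤ Fintype.card ι * (A⁻¹ * H * A⁻¹ * H).trace := by
  obtain ⟨B, K, -, -, -, h1, h⟩ := exists_normal_form hA hH
  rw [h, h1, Matrix.trace]
  refine (sq_sum_le_card_mul_sum_sq).trans ?_
  refine mul_le_mul_of_nonneg_left (Finset.sum_le_sum fun i _ => ?_) (by positivity)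
  exact Finset.single_le_sum (f := fun j => K i j ^ 2) (fun j _ => sq_nonneg _) (Finset.mem_univ i)

theorem abs_trace_le (hA : A.PosDef) (hH : Hᵀ = H) :
    |(A⁻¹ * H).trace| ≤ √(Fintype.card ι) * √(A⁻¹ * H * A⁻¹ * H).trace := by
  rw [← Real.sqrt_mul (by positivity)]
  exact Real.abs_le_sqrt (sq_trace_le hA hH)

/-- In the orthonormal frame this is `|wᵀKw| ≤ |w|² ‖K‖` with the Frobenius norm: Cauchy–Schwarz
over pairs of indices. -/
theorem abs_dotProduct_mulVec_le (hA : A.PosDef) (hH : Hᵀ = H) (v : ι → ℝ) :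
    |v ⬝ᵥ (H *ᵥ v)| ≤ v ⬝ᵥ (A *ᵥ v) * √(A⁻¹ * H * A⁻¹ * H).trace := by
  obtain ⟨B, K, e1, e2, -, -, h⟩ := exists_normal_form hA hH
  rw [h, e1, e2]
  have hv : ∀ L : Matrix ι ι ℝ, v ⬝ᵥ ((Bᵀ * L * B) *ᵥ v) = (B *ᵥ v) ⬝ᵥ (L *ᵥ (B *ᵥ v)) := by
    intro L
    rw [← Matrix.mulVec_mulVec, ← Matrix.mulVec_mulVec, Matrix.dotProduct_mulVec,
      Matrix.vecMul_transpose]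
  have h1 : v ⬝ᵥ ((Bᵀ * B) *ᵥ v) = (B *ᵥ v) ⬝ᵥ (B *ᵥ v) := by
    simpa using hv 1
  rw [hv, h1]
  generalize B *ᵥ v = w
  have hw : 0 ≤ w ⬝ᵥ w := Finset.sum_nonneg fun i _ => mul_self_nonneg (w i)
  rw [← Real.sqrt_sq hw, ← Real.sqrt_mul (sq_nonneg _)]
  refine Real.abs_le_sqrt ?_
  have e3 : w ⬝ᵥ (K *ᵥ w) = ∑ p : ι × ι, (w p.1 * w p.2) * K p.1 p.2 := by
    rw [Fintype.sum_prod_type]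
    simp only [dotProduct, Matrix.mulVec, Finset.mul_sum]
    exact Finset.sum_congr rfl fun i _ => Finset.sum_congr rfl fun j _ => by ring
  have e4 : (w ⬝ᵥ w) ^ 2 = ∑ p : ι × ι, (w p.1 * w p.2) ^ 2 := by
    rw [Fintype.sum_prod_type, sq, dotProduct, Finset.sum_mul_sum]
    exact Finset.sum_congr rfl fun i _ => Finset.sum_congr rfl fun j _ => by ring
  have e5 : ∑ i, ∑ j, K i j ^ 2 = ∑ p : ι × ι, K p.1 p.2 ^ 2 :=
    (Fintype.sum_prod_type (fun p : ι × ι => K p.1 p.2 ^ 2)).symm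
  rw [e3, e4, e5]
  exact Finset.sum_mul_sq_le_sq_mul_sq _ _ _

/-- Jacobi's formula at a positive definite matrix. -/
theorem hasDerivWithinAt_det_of_posDef {A : ℝ → Matrix ι ι ℝ} {s : Set ℝ} {t : ℝ}
    (hA : (A t).PosDef) (h : ∀ i j, HasDerivWithinAt (fun r => A r i j) (H i j) s t) :
    HasDerivWithinAt (fun r => (A r).det) ((A t).det * ((A t)⁻¹ * H).trace) s t := by
  convert hasDerivWithinAt_det h using 1
  rw [Matrix.inv_def, Matrix.smul_mul, Matrix.trace_smul, smul_eq_mul, ← mul_assoc,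
    Ring.mul_inverse_cancel _ (isUnit_iff_ne_zero.2 hA.det_pos.ne'), one_mul]

/-- The derivative of `√det A` along a curve of positive definite matrices. -/
theorem hasDerivWithinAt_sqrt_det {A : ℝ → Matrix ι ι ℝ} {s : Set ℝ} {t : ℝ}
    (hA : (A t).PosDef) (h : ∀ i j, HasDerivWithinAt (fun r => A r i j) (H i j) s t) :
    HasDerivWithinAt (fun r => √(A r).det) (√(A t).det * ((A t)⁻¹ * H).trace / 2) s t := by
  convert (hasDerivWithinAt_det_of_posDef hA h).sqrt hA.det_pos.ne' using 1
  have h0 := Real.sqrt_pos.2 hA.det_pos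
  have h1 := Real.mul_self_sqrt hA.det_pos.le
  field_simp
  linear_combination ((A t)⁻¹ * H).trace * h1

/-- The derivative of `(det A)^{1/4}` along a curve of positive definite matrices. -/
theorem hasDerivWithinAt_sqrt_sqrt_det {A : ℝ → Matrix ι ι ℝ} {s : Set ℝ} {t : ℝ}
    (hA : (A t).PosDef) (h : ∀ i j, HasDerivWithinAt (fun r => A r i j) (H i j) s t) :
    HasDerivWithinAt (fun r => √√(A r).det) (√√(A t).det * ((A t)⁻¹ * H).trace / 4) s t := by
  have h0 := Real.sqrt_pos.2 hA.det_pos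
  convert (hasDerivWithinAt_sqrt_det hA h).sqrt h0.ne' using 1
  have h2 := Real.sqrt_pos.2 h0
  have h1 := Real.mul_self_sqrt h0.le
  field_simp
  linear_combination 4 * ((A t)⁻¹ * H).trace * h1

end Inequalities

/-! ### Variation of piecewise `C¹` functions and Minkowski's integral inequality -/

theorem ofReal_abs_sub_le_lintegral {f f' : ℝ → ℝ} {a b s : ℝ}
    (hf : ∀ r ∈ Icc a b, HasDerivWithinAt f (f' r) (Icc a b) r) (hc : ContinuousOn f' (Icc a b))
    (hs : s ∈ Icc a b) :
    ENNReal.ofReal |f s - f a| ≤ ∫⁻ r in Icc a b, ENNReal.ofReal |f' r| := by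
  have hsub : Icc a s ⊆ Icc a b := Icc_subset_Icc_right hs.2
  have hd : ∀ x ∈ Ioo a s, HasDerivWithinAt f (f' x) (Ioi x) x := fun x hx => by
    have hx' : x ∈ Icc a b := ⟨hx.1.le, hx.2.le.trans hs.2⟩
    refine (hf x hx').mono_of_mem_nhdsWithin ?_
    exact mem_nhdsWithin_of_mem_nhds (Icc_mem_nhds hx.1 (hx.2.trans_le hs.2))
  have h1 := intervalIntegral.integral_eq_sub_of_hasDeriv_right_of_le hs.1
    (fun r hr => ((hf r (hsub hr)).continuousWithinAt.mono hsub)) hd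
    ((hc.mono (by rw [uIcc_of_le hs.1]; exact hsub)).intervalIntegrable)
  rw [← h1, intervalIntegral.integral_of_le hs.1]
  calc ENNReal.ofReal |∫ r in Ioc a s, f' r| = ‖∫ r in Ioc a s, f' r‖ₑ := by
        rw [← Real.norm_eq_abs, ofReal_norm]
    _ ≤ ∫⁻ r in Ioc a s, ‖f' r‖ₑ := enorm_integral_le_lintegral_enorm _
    _ ≤ ∫⁻ r in Icc a b, ‖f' r‖ₑ :=
        lintegral_mono_set (Ioc_subset_Icc_self.trans hsub)
    _ = _ := by simp only [← ofReal_norm, Real.norm_eq_abs]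

/-- The variation of a piecewise `C¹` function is bounded by the integral of its speed. -/
theorem ofReal_abs_sub_le_sum_lintegral {f : ℝ → ℝ} {f' : ℕ → ℝ → ℝ} {t : ℕ → ℝ}
    (ht : Monotone t) {m : ℕ}
    (hf : ∀ i < m, ∀ r ∈ Icc (t i) (t (i + 1)),
      HasDerivWithinAt f (f' i r) (Icc (t i) (t (i + 1))) r)
    (hc : ∀ i < m, ContinuousOn (f' i) (Icc (t i) (t (i + 1)))) {s : ℝ}
    (hs : s ∈ Icc (t 0) (t m)) :
    ENNReal.ofReal |f s - f (t 0)| ≤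
      ∑ i ∈ Finset.range m, ∫⁻ r in Icc (t i) (t (i + 1)), ENNReal.ofReal |f' i r| := by
  induction m generalizing s with
  | zero =>
    have : s = t 0 := le_antisymm hs.2 hs.1
    simp [this]
  | succ m ih =>
    have ih : ∀ {s : ℝ}, s ∈ Icc (t 0) (t m) → _ := @ih (fun i hi => hf i (hi.trans m.lt_succ_self))
      (fun i hi => hc i (hi.trans m.lt_succ_self))
    rw [Finset.sum_range_succ]
    rcases le_total s (t m) with h | h
    · exact (ih ⟨hs.1, h⟩).trans le_self_add
    · have h1 := ofReal_abs_sub_le_lintegral (hf m m.lt_succ_self) (hc m m.lt_succ_self)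
        (⟨h, hs.2⟩ : s ∈ Icc (t m) (t (m + 1)))
      have h2 := ih (⟨ht m.zero_le, le_rfl⟩ : t m ∈ Icc (t 0) (t m))
      calc ENNReal.ofReal |f s - f (t 0)|
          ≤ ENNReal.ofReal (|f (t m) - f (t 0)| + |f s - f (t m)|) := by
            refine ENNReal.ofReal_le_ofReal ?_
            rw [add_comm]
            exact abs_sub_le _ _ _
        _ = ENNReal.ofReal |f (t m) - f (t 0)| + ENNReal.ofReal |f s - f (t m)| :=
            ENNReal.ofReal_add (abs_nonneg _) (abs_nonneg _)
        _ ≤ _ := add_le_add h2 h1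

/-- Minkowski's integral inequality in `L²`. -/
theorem lintegral_lintegral_sq_le {α β : Type*} [MeasurableSpace α] [MeasurableSpace β]
    (μ : Measure α) (ν : Measure β) [SFinite μ] [SFinite ν] {F : α → β → ℝ≥0∞}
    (hF : Measurable (Function.uncurry F)) :
    (∫⁻ x, (∫⁻ y, F x y ∂ν) ^ 2 ∂μ) ^ (1 / 2 : ℝ) ≤
      ∫⁻ y, (∫⁻ x, F x y ^ 2 ∂μ) ^ (1 / 2 : ℝ) ∂ν := by
  have hx : ∀ x, Measurable (F x) := fun x => hF.comp measurable_prodMk_left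
  have hy : ∀ y, Measurable fun x => F x y := fun y => hF.comp measurable_prodMk_right
  have hN : Measurable fun y => (∫⁻ x, F x y ^ 2 ∂μ) ^ (1 / 2 : ℝ) := by
    refine Measurable.pow_const ?_ _
    exact Measurable.lintegral_prod_left' (f := fun p : α × β => F p.1 p.2 ^ 2) (hF.pow_const 2)
  -- The square is written as a double integral, so that Tonelli and then Cauchy–Schwarz in `x`
  -- apply for each pair `(y, z)`.
  have e1 : ∀ x, (∫⁻ y, F x y ∂ν) ^ 2 = ∫⁻ y, ∫⁻ z, F x y * F x z ∂ν ∂ν := by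
    intro x
    rw [sq, ← lintegral_mul_const _ (hx x)]
    exact lintegral_congr fun y => (lintegral_const_mul _ (hx x)).symm
  have key : ∫⁻ x, (∫⁻ y, F x y ∂ν) ^ 2 ∂μ ≤ (∫⁻ y, (∫⁻ x, F x y ^ 2 ∂μ) ^ (1 / 2 : ℝ) ∂ν) ^ 2 := by
    calc ∫⁻ x, (∫⁻ y, F x y ∂ν) ^ 2 ∂μ = ∫⁻ x, ∫⁻ y, ∫⁻ z, F x y * F x z ∂ν ∂ν ∂μ :=
          lintegral_congr e1
      _ = ∫⁻ y, ∫⁻ x, ∫⁻ z, F x y * F x z ∂ν ∂μ ∂ν := by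
          refine lintegral_lintegral_swap (Measurable.aemeasurable ?_)
          refine Measurable.lintegral_prod_right'
            (f := fun p : (α × β) × β => F p.1.1 p.1.2 * F p.1.1 p.2) ?_
          exact (hF.comp measurable_fst).mul
            (hF.comp ((measurable_fst.comp measurable_fst).prodMk measurable_snd))
      _ = ∫⁻ y, ∫⁻ z, ∫⁻ x, F x y * F x z ∂μ ∂ν ∂ν := by
          refine lintegral_congr fun y => lintegral_lintegral_swap (Measurable.aemeasurable ?_)
          exact ((hy y).comp measurable_fst).mul hF
      _ ≤ ∫⁻ y, ∫⁻ z, (∫⁻ x, F x y ^ 2 ∂μ) ^ (1 / 2 : ℝ) *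
            (∫⁻ x, F x z ^ 2 ∂μ) ^ (1 / 2 : ℝ) ∂ν ∂ν := by
          refine lintegral_mono fun y => lintegral_mono fun z => ?_
          have := ENNReal.lintegral_mul_le_Lp_mul_Lq μ Real.HolderConjugate.two_two
            (hy y).aemeasurable (hy z).aemeasurable
          simpa only [Pi.mul_apply, ENNReal.rpow_two] using this
      _ = (∫⁻ y, (∫⁻ x, F x y ^ 2 ∂μ) ^ (1 / 2 : ℝ) ∂ν) ^ 2 := by
          rw [sq, ← lintegral_mul_const _ hN]
          exact lintegral_congr fun y => lintegral_const_mul _ hN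
  calc (∫⁻ x, (∫⁻ y, F x y ∂ν) ^ 2 ∂μ) ^ (1 / 2 : ℝ)
      ≤ ((∫⁻ y, (∫⁻ x, F x y ^ 2 ∂μ) ^ (1 / 2 : ℝ) ∂ν) ^ 2) ^ (1 / 2 : ℝ) :=
        ENNReal.rpow_le_rpow key (by norm_num)
    _ = _ := by
        rw [← ENNReal.rpow_two, ← ENNReal.rpow_mul]
        norm_num

/-- Minkowski's inequality in `L²` for a series. -/
theorem lintegral_tsum_sq_le {α : Type*} [MeasurableSpace α] (μ : Measure α) [SFinite μ]
    {F : ℕ → α → ℝ≥0∞} (hF : ∀ k, Measurable (F k)) :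
    (∫⁻ x, (∑' k, F k x) ^ 2 ∂μ) ^ (1 / 2 : ℝ) ≤ ∑' k, (∫⁻ x, F k x ^ 2 ∂μ) ^ (1 / 2 : ℝ) := by
  -- A series is an integral for counting measure.
  have := lintegral_lintegral_sq_le μ (Measure.count : Measure ℕ) (F := fun x k => F k x)
    (measurable_from_prod_countable_left hF)
  simpa only [lintegral_count] using this

/-! ### Bilinear forms, their matrices and their convergence -/

section

theorem tendsto_sum_sum_smul {G ι κ : Type*} [NormedAddCommGroup G] [NormedSpace ℝ G] [Fintype κ]
    {l : Filter ι} {m : ι → κ → κ → ℝ} {L : κ → κ → ℝ}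
    (h : ∀ i j, Tendsto (fun k => m k i j) l (𝓝 (L i j))) (D : κ → κ → G) :
    Tendsto (fun k => ∑ i, ∑ j, m k i j • D i j) l (𝓝 (∑ i, ∑ j, L i j • D i j)) :=
  tendsto_finsetSum _ fun i _ => tendsto_finsetSum _ fun j _ => (h i j).smul_const _

/-- Expanding in the products `D i j` of coordinate functionals leaves finitely many real
coefficients to converge. -/
theorem exists_tendsto_clm_clm {E : Type*} [NormedAddCommGroup E] [NormedSpace ℝ E]
    [FiniteDimensional ℝ E] {ι : Type*} {l : Filter ι} {a : ι → E →L[ℝ] E →L[ℝ] ℝ}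
    (h : ∀ v w, ∃ L : ℝ, Tendsto (fun k => a k v w) l (𝓝 L)) :
    ∃ B : E →L[ℝ] E →L[ℝ] ℝ, Tendsto a l (𝓝 B) := by
  let b := Module.finBasis ℝ E
  let φ : Fin _ → (E →L[ℝ] ℝ) := fun i => LinearMap.toContinuousLinearMap (b.coord i)
  let D : Fin _ → Fin _ → (E →L[ℝ] E →L[ℝ] ℝ) := fun i j => (φ i).smulRight (φ j)
  have hD : ∀ B : E →L[ℝ] E →L[ℝ] ℝ, B = ∑ i, ∑ j, B (b i) (b j) • D i j := by
    intro B
    refine ContinuousLinearMap.ext fun v => ContinuousLinearMap.ext fun w => ?_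
    conv_lhs => rw [← b.sum_repr v, ← b.sum_repr w]
    simp only [map_sum, map_smul, _root_.sum_apply, _root_.smul_apply, smul_eq_mul, D, φ,
      ContinuousLinearMap.smulRight_apply, LinearMap.coe_toContinuousLinearMap',
      Module.Basis.coord_apply, Finset.mul_sum]
    rw [Finset.sum_comm]
    exact Finset.sum_congr rfl fun i _ => Finset.sum_congr rfl fun j _ => by ring
  choose L hL using h
  refine ⟨∑ i, ∑ j, L (b i) (b j) • D i j, ?_⟩
  rw [show a = fun k => ∑ i, ∑ j, a k (b i) (b j) • D i j from funext fun k => hD (a k)]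
  exact tendsto_sum_sum_smul (fun i j => hL (b i) (b j)) D

end

section Forms

variable {n : ℕ} {M : Type u} [TopologicalSpace M] [ChartedSpace (EuclideanSpace ℝ (Fin n)) M]
  [IsManifold (𝓡 n) ∞ M]

/-- The coordinate vectors of a chart form a basis of the tangent space. -/
noncomputable def coordBasis {c x : M}
    (hx : x ∈ (chartAt (EuclideanSpace ℝ (Fin n)) c).source) :
    Module.Basis (Fin n) ℝ (TangentSpace (𝓡 n) x) :=
  (EuclideanSpace.basisFun (Fin n) ℝ).toBasis.map
    ((trivializationAt (EuclideanSpace ℝ (Fin n))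
      (fun y : M => TangentSpace (𝓡 n) y) c).continuousLinearEquivAt ℝ x
      (by simpa using hx)).symm.toLinearEquiv

theorem coordBasis_apply {c x : M}
    (hx : x ∈ (chartAt (EuclideanSpace ℝ (Fin n)) c).source) (i : Fin n) :
    coordBasis hx i = coordVec c x i := by
  simp only [coordBasis, coordVec, Module.Basis.map_apply, OrthonormalBasis.coe_toBasis,
    EuclideanSpace.basisFun_apply]
  exact congrFun ((trivializationAt (EuclideanSpace ℝ (Fin n))
      (fun y : M => TangentSpace (𝓡 n) y) c).symm_continuousLinearEquivAt_eq (R := ℝ)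
        (b := x) (by simpa using hx)) _

theorem gramIn_apply (c : M) {x : M} (B : TwoForm n M x) (i j : Fin n) :
    gramIn c B i j = B (coordVec c x i) (coordVec c x j) := rfl

open Matrix in
theorem apply_eq_dotProduct_gramIn {c x : M}
    (hx : x ∈ (chartAt (EuclideanSpace ℝ (Fin n)) c).source) (B : TwoForm n M x)
    (v w : TangentSpace (𝓡 n) x) :
    B v w = (coordBasis hx).repr v ⬝ᵥ (gramIn c B *ᵥ (coordBasis hx).repr w) := by
  conv_lhs => rw [← (coordBasis hx).sum_repr v, ← (coordBasis hx).sum_repr w]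
  simp only [map_sum, map_smul, _root_.sum_apply, _root_.smul_apply,
    dotProduct, mulVec, Finset.mul_sum, coordBasis_apply, gramIn_apply, smul_eq_mul]
  rw [Finset.sum_comm]
  exact Finset.sum_congr rfl fun i _ => Finset.sum_congr rfl fun j _ => by ring

theorem gramIn_transpose {c x : M} {B : TwoForm n M x} (hB : ∀ v w, B v w = B w v) :
    (gramIn c B).transpose = gramIn c B := by
  ext i j
  exact hB _ _

theorem posDef_gramIn {c x : M} (hx : x ∈ (chartAt (EuclideanSpace ℝ (Fin n)) c).source)
    {B : TwoForm n M x} (hB : ∀ v w, B v w = B w v) (hpos : IsPosDef B) :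
    (gramIn c B).PosDef := by
  refine .of_dotProduct_mulVec_pos ?_ fun v hv => ?_
  · simpa [Matrix.IsHermitian] using gramIn_transpose hB
  · have h := apply_eq_dotProduct_gramIn hx B ((coordBasis hx).equivFun.symm v)
      ((coordBasis hx).equivFun.symm v)
    have e : ((coordBasis hx).repr ((coordBasis hx).equivFun.symm v) : Fin n → ℝ) = v :=
      (coordBasis hx).equivFun.apply_symm_apply v
    rw [e] at h
    simp only [star_trivial]
    rw [← h]
    exact hpos _ (by rwa [Ne, LinearEquiv.map_eq_zero_iff])

theorem posSemidef_gramIn {c x : M} (hx : x ∈ (chartAt (EuclideanSpace ℝ (Fin n)) c).source)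
    {B : TwoForm n M x} (hB : ∀ v w, B v w = B w v) (hpos : ∀ v, 0 ≤ B v v) :
    (gramIn c B).PosSemidef := by
  refine .of_dotProduct_mulVec_nonneg ?_ fun v => ?_
  · simpa [Matrix.IsHermitian] using gramIn_transpose hB
  · have h := apply_eq_dotProduct_gramIn hx B ((coordBasis hx).equivFun.symm v)
      ((coordBasis hx).equivFun.symm v)
    have e : ((coordBasis hx).repr ((coordBasis hx).equivFun.symm v) : Fin n → ℝ) = v :=
      (coordBasis hx).equivFun.apply_symm_apply v
    rw [e] at h
    simp only [star_trivial]
    rw [← h]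
    exact hpos _

/-- A semidefinite matrix is definite exactly when it is nonsingular. This turns deflation into
vanishing of the volume density. -/
theorem isPosDef_iff_det_gramIn_ne_zero {c x : M}
    (hx : x ∈ (chartAt (EuclideanSpace ℝ (Fin n)) c).source)
    {B : TwoForm n M x} (hB : ∀ v w, B v w = B w v) (hpos : ∀ v, 0 ≤ B v v) :
    IsPosDef B ↔ (gramIn c B).det ≠ 0 := by
  refine ⟨fun h => (posDef_gramIn hx hB h).det_pos.ne', fun h v hv => ?_⟩
  have hp := ((posSemidef_gramIn hx hB hpos).posDef_iff_det_ne_zero).2 h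
  rw [apply_eq_dotProduct_gramIn hx]
  have := hp.dotProduct_mulVec_pos (x := (coordBasis hx).repr v) (by simpa using hv)
  simpa using this

/-- A family of bilinear forms converges if its values at all pairs of vectors do. -/
theorem exists_tendsto_twoForm {x : M} {ι : Type*} {l : Filter ι} {a : ι → TwoForm n M x}
    (h : ∀ v w, ∃ L : ℝ, Tendsto (fun k => a k v w) l (𝓝 L)) :
    ∃ B : TwoForm n M x, Tendsto a l (𝓝 B) :=
  exists_tendsto_clm_clm (E := EuclideanSpace ℝ (Fin n)) h

theorem tendsto_apply_of_tendsto {x : M} {ι : Type*} {l : Filter ι} {a : ι → TwoForm n M x}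
    {B : TwoForm n M x} (h : Tendsto a l (𝓝 B)) (v w : TangentSpace (𝓡 n) x) :
    Tendsto (fun k => a k v w) l (𝓝 (B v w)) := by
  have h1 : Tendsto (fun k => a k v) l (𝓝 (B v)) :=
    ((continuous_eval_const v).tendsto B).comp h
  exact ((continuous_eval_const w).tendsto (B v)).comp h1

end Forms

/-! ### Continuity of matrix operations and sums over partition intervals -/

theorem continuousOn_matrix_inv {X ι : Type*} [TopologicalSpace X] [Fintype ι] [DecidableEq ι]
    {A : X → Matrix ι ι ℝ} {s : Set X} (hA : ContinuousOn A s) (h : ∀ r ∈ s, (A r).det ≠ 0) :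
    ContinuousOn (fun r => (A r)⁻¹) s := by
  rw [continuousOn_iff_continuous_domRestrict] at hA ⊢
  have h1 : s.domRestrict (fun r => (A r)⁻¹) =
      fun r => ((s.domRestrict A r).det)⁻¹ • (s.domRestrict A r).adjugate := by
    funext r
    simp [Matrix.inv_def, Set.domRestrict]
  rw [h1]
  exact (hA.matrix_det.inv₀ fun r => h r r.2).smul hA.matrix_adjugate

theorem continuousOn_matrix_trace_inv_mul {X ι : Type*} [TopologicalSpace X] [Fintype ι]
    [DecidableEq ι] {A H : X → Matrix ι ι ℝ} {s : Set X} (hA : ContinuousOn A s)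
    (hH : ContinuousOn H s) (h : ∀ r ∈ s, (A r).det ≠ 0) :
    ContinuousOn (fun r => ((A r)⁻¹ * H r).trace) s := by
  have hi := continuousOn_matrix_inv hA h
  rw [continuousOn_iff_continuous_domRestrict] at hi hH ⊢
  exact (hi.matrix_mul hH).matrix_trace

theorem continuousOn_matrix_det {X ι : Type*} [TopologicalSpace X] [Fintype ι] [DecidableEq ι]
    {A : X → Matrix ι ι ℝ} {s : Set X} (hA : ContinuousOn A s) :
    ContinuousOn (fun r => (A r).det) s := by
  rw [continuousOn_iff_continuous_domRestrict] at hA ⊢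
  exact hA.matrix_det

theorem continuousOn_matrix {X ι : Type*} [TopologicalSpace X]
    {A : X → Matrix ι ι ℝ} {s : Set X} (hA : ∀ i j, ContinuousOn (fun r => A r i j) s) :
    ContinuousOn A s :=
  continuousOn_pi.2 fun i => continuousOn_pi.2 fun j => hA i j

/-- Comparison of integrals over the pieces of a partition; degenerate pieces are irrelevant. -/
theorem sum_lintegral_Icc_mono {t : ℕ → ℝ} {m : ℕ} {F G : ℕ → ℝ → ℝ≥0∞}
    (h : ∀ i < m, t i < t (i + 1) → ∀ s ∈ Icc (t i) (t (i + 1)), F i s ≤ G i s) :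
    ∑ i ∈ Finset.range m, ∫⁻ s in Icc (t i) (t (i + 1)), F i s ≤
      ∑ i ∈ Finset.range m, ∫⁻ s in Icc (t i) (t (i + 1)), G i s := by
  refine Finset.sum_le_sum fun i hi => ?_
  rcases lt_or_ge (t i) (t (i + 1)) with hlt | hge
  · exact setLIntegral_mono' measurableSet_Icc (h i (Finset.mem_range.1 hi) hlt)
  · have : volume (Icc (t i) (t (i + 1))) = 0 := by
      rw [Real.volume_Icc]
      simpa using hge
    rw [setLIntegral_measure_zero _ _ this]
    exact zero_le

theorem sum_lintegral_const_mul {t : ℕ → ℝ} {m : ℕ} {F : ℕ → ℝ → ℝ≥0∞} {c : ℝ≥0∞}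
    (hc : c ≠ ⊤) :
    ∑ i ∈ Finset.range m, ∫⁻ s in Icc (t i) (t (i + 1)), c * F i s =
      c * ∑ i ∈ Finset.range m, ∫⁻ s in Icc (t i) (t (i + 1)), F i s := by
  rw [Finset.mul_sum]
  exact Finset.sum_congr rfl fun i _ => lintegral_const_mul' _ _ hc

/-! ### Estimates along a path of positive definite forms at one point -/

section Fiber

variable {n : ℕ} {M : Type u} [TopologicalSpace M] [ChartedSpace (EuclideanSpace ℝ (Fin n)) M]
  [IsManifold (𝓡 n) ∞ M] [MeasurableSpace M] [BorelSpace M] [CompactSpace M]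

theorem mem_coords_source (x : M) :
    x ∈ (chartAt (EuclideanSpace ℝ (Fin n)) ((coords n M).center ((coords n M).index x))).source :=
  (coords n M).mem_source x

theorem gram_transpose {x : M} {B : TwoForm n M x} (hB : ∀ v w, B v w = B w v) :
    (gram B).transpose = gram B :=
  gramIn_transpose hB

theorem posDef_gram {x : M} {B : TwoForm n M x} (hB : ∀ v w, B v w = B w v)
    (hpos : IsPosDef B) : (gram B).PosDef :=
  posDef_gramIn (mem_coords_source x) hB hpos

theorem relDet_eq {x : M} (g a : TwoForm n M x) : relDet g a = (gram a).det / (gram g).det := by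
  rw [relDet, Matrix.det_mul, Matrix.det_nonsing_inv, Ring.inverse_eq_inv', mul_comm, div_eq_mul_inv]

theorem abs_apply_le {x : M} {a h : TwoForm n M x} (ha : ∀ v w, a v w = a w v) (hp : IsPosDef a)
    (hh : ∀ v w, h v w = h w v) (v : TangentSpace (𝓡 n) x) :
    |h v v| ≤ a v v * √(trProd a h h) := by
  rw [apply_eq_dotProduct_gramIn (mem_coords_source x) h,
    apply_eq_dotProduct_gramIn (mem_coords_source x) a]
  exact abs_dotProduct_mulVec_le (posDef_gram ha hp) (gram_transpose hh) _

theorem trProd_nonneg {x : M} {a h : TwoForm n M x} (ha : ∀ v w, a v w = a w v) (hp : IsPosDef a)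
    (hh : ∀ v w, h v w = h w v) : 0 ≤ trProd a h h :=
  trace_sq_nonneg (posDef_gram ha hp) (gram_transpose hh)

namespace FiberPath

variable {x : M} {a₀ a₁ a₂ : TwoForm n M x} (γ : FiberPath a₀ a₁)

theorem Icc_subset {i : ℕ} (hi : i < γ.pieces) :
    Icc (γ.t i) (γ.t (i + 1)) ⊆ Icc (γ.t 0) (γ.t γ.pieces) :=
  Icc_subset_Icc (γ.monotone i.zero_le) (γ.monotone hi)

theorem right_mem : γ.t γ.pieces ∈ Icc (γ.t 0) (γ.t γ.pieces) :=
  ⟨γ.monotone (Nat.zero_le _), le_rfl⟩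

theorem posDef_gram_curve {s : ℝ} (hs : s ∈ Icc (γ.t 0) (γ.t γ.pieces)) :
    (gram (γ.curve s)).PosDef :=
  posDef_gram (γ.symm s hs) (γ.posDef s hs)

/-- Symmetry passes to the derivative by its uniqueness. On a one-point interval derivatives are not
unique, whence the strict inequality; such intervals contribute nothing to the integrals. -/
theorem vel_symm {i : ℕ} (hi : i < γ.pieces) (hlt : γ.t i < γ.t (i + 1)) {s : ℝ}
    (hs : s ∈ Icc (γ.t i) (γ.t (i + 1))) (v w : TangentSpace (𝓡 n) x) :
    γ.vel i s v w = γ.vel i s w v := by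
  refine (uniqueDiffOn_Icc hlt s hs).eq_deriv _ (γ.hasDeriv i hi s hs v w) ?_
  refine (γ.hasDeriv i hi s hs w v).congr (fun r hr => ?_) ?_
  · exact γ.symm r (γ.Icc_subset hi hr) v w
  · exact γ.symm s (γ.Icc_subset hi hs) v w

theorem hasDeriv_gram {i : ℕ} (hi : i < γ.pieces) {s : ℝ}
    (hs : s ∈ Icc (γ.t i) (γ.t (i + 1))) (j k : Fin n) :
    HasDerivWithinAt (fun r => gram (γ.curve r) j k) (gram (γ.vel i s) j k)
      (Icc (γ.t i) (γ.t (i + 1))) s :=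
  γ.hasDeriv i hi s hs _ _

theorem continuousOn_gram_curve {i : ℕ} (hi : i < γ.pieces) :
    ContinuousOn (fun r => gram (γ.curve r)) (Icc (γ.t i) (γ.t (i + 1))) :=
  continuousOn_matrix fun j k _ hs => (γ.hasDeriv_gram hi hs j k).continuousWithinAt

theorem continuousOn_gram_vel {i : ℕ} (hi : i < γ.pieces) :
    ContinuousOn (fun r => gram (γ.vel i r)) (Icc (γ.t i) (γ.t (i + 1))) :=
  continuousOn_matrix fun _ _ => γ.continuous_vel i hi _ _

theorem continuousOn_trace {i : ℕ} (hi : i < γ.pieces) :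
    ContinuousOn (fun r => ((gram (γ.curve r))⁻¹ * gram (γ.vel i r)).trace)
      (Icc (γ.t i) (γ.t (i + 1))) :=
  continuousOn_matrix_trace_inv_mul (γ.continuousOn_gram_curve hi) (γ.continuousOn_gram_vel hi)
    fun _ hr => (γ.posDef_gram_curve (γ.Icc_subset hi hr)).det_pos.ne'

/-- The length of the path for the density `tr_a(h²) √(det a)`, computed in coordinates. -/
noncomputable def amplitude : ℝ≥0∞ :=
  ∑ i ∈ Finset.range γ.pieces, ∫⁻ s in Icc (γ.t i) (γ.t (i + 1)),
    ENNReal.ofReal (√(trProd (γ.curve s) (γ.vel i s) (γ.vel i s) * √(gram (γ.curve s)).det))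

theorem abs_trace_le {i : ℕ} (hi : i < γ.pieces) (hlt : γ.t i < γ.t (i + 1)) {s : ℝ}
    (hs : s ∈ Icc (γ.t i) (γ.t (i + 1))) :
    |((gram (γ.curve s))⁻¹ * gram (γ.vel i s)).trace| ≤
      √n * √(trProd (γ.curve s) (γ.vel i s) (γ.vel i s)) := by
  have := ManifoldOfMetrics.abs_trace_le (γ.posDef_gram_curve (γ.Icc_subset hi hs))
    (gram_transpose (γ.vel_symm hi hlt hs))
  rwa [Fintype.card_fin] at this

theorem trProd_nonneg {i : ℕ} (hi : i < γ.pieces) (hlt : γ.t i < γ.t (i + 1)) {s : ℝ}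
    (hs : s ∈ Icc (γ.t i) (γ.t (i + 1))) :
    0 ≤ trProd (γ.curve s) (γ.vel i s) (γ.vel i s) :=
  ManifoldOfMetrics.trProd_nonneg (γ.symm s (γ.Icc_subset hi hs))
    (γ.posDef s (γ.Icc_subset hi hs)) (γ.vel_symm hi hlt hs)

/-- The derivative of `(det a)^{1/4}` is `(det a)^{1/4} tr(a⁻¹h)/4`, and `|tr(a⁻¹h)| ≤ √n
√tr_a(h²)`; what remains is the integrand of the amplitude. -/
theorem ofReal_abs_sub_sqrt_sqrt_det_le {s : ℝ} (hs : s ∈ Icc (γ.t 0) (γ.t γ.pieces)) :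
    ENNReal.ofReal |√√(gram (γ.curve s)).det - √√(gram a₀).det| ≤
      ENNReal.ofReal (√n / 4) * γ.amplitude := by
  have h := ofReal_abs_sub_le_sum_lintegral (f := fun s => √√(gram (γ.curve s)).det)
    (f' := fun i s => √√(gram (γ.curve s)).det *
      ((gram (γ.curve s))⁻¹ * gram (γ.vel i s)).trace / 4) γ.monotone
    (fun i hi r hr => hasDerivWithinAt_sqrt_sqrt_det (γ.posDef_gram_curve (γ.Icc_subset hi hr))
      (γ.hasDeriv_gram hi hr))
    (fun i hi => (((continuousOn_matrix_det (γ.continuousOn_gram_curve hi)).sqrt.sqrt).mul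
      (γ.continuousOn_trace hi)).div_const 4) hs
  rw [γ.source_eq] at h
  refine h.trans ?_
  rw [amplitude, ← sum_lintegral_const_mul ENNReal.ofReal_ne_top]
  refine sum_lintegral_Icc_mono fun i hi hlt r hr => ?_
  rw [← ENNReal.ofReal_mul (by positivity)]
  refine ENNReal.ofReal_le_ofReal ?_
  rw [abs_div, abs_mul, abs_of_nonneg (Real.sqrt_nonneg _), abs_of_pos (by norm_num : (0 : ℝ) < 4),
    Real.sqrt_mul (γ.trProd_nonneg hi hlt hr)]
  have := mul_le_mul_of_nonneg_left (γ.abs_trace_le hi hlt hr)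
    (Real.sqrt_nonneg √(gram (γ.curve r)).det)
  calc _ ≤ √√(gram (γ.curve r)).det * (√n * √(trProd (γ.curve r) (γ.vel i r) (γ.vel i r))) / 4 := by
        gcongr
    _ = _ := by ring

/-- The same computation for `√det`, whose derivative is bounded by the `θ`-speed instead of the
amplitude integrand. -/
theorem ofReal_abs_sub_sqrt_relDet_le {g : TwoForm n M x} (hg : 0 < (gram g).det) {s : ℝ}
    (hs : s ∈ Icc (γ.t 0) (γ.t γ.pieces)) :
    ENNReal.ofReal |√(relDet g (γ.curve s)) - √(relDet g a₀)| ≤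
      ENNReal.ofReal (√n / 2) * γ.length g := by
  have h := ofReal_abs_sub_le_sum_lintegral
    (f := fun s => √(gram (γ.curve s)).det / √(gram g).det)
    (f' := fun i s => √(gram (γ.curve s)).det *
      ((gram (γ.curve s))⁻¹ * gram (γ.vel i s)).trace / 2 / √(gram g).det) γ.monotone
    (fun i hi r hr => (hasDerivWithinAt_sqrt_det (γ.posDef_gram_curve (γ.Icc_subset hi hr))
      (γ.hasDeriv_gram hi hr)).div_const _)
    (fun i hi => ((((continuousOn_matrix_det (γ.continuousOn_gram_curve hi)).sqrt).mul
      (γ.continuousOn_trace hi)).div_const 2).div_const _) hs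
  rw [γ.source_eq] at h
  have e : ∀ a : TwoForm n M x, √(relDet g a) = √(gram a).det / √(gram g).det := fun a => by
    rw [relDet_eq, Real.sqrt_div' _ hg.le]
  rw [e, e]
  refine h.trans ?_
  rw [length, ← sum_lintegral_const_mul ENNReal.ofReal_ne_top]
  refine sum_lintegral_Icc_mono fun i hi hlt r hr => ?_
  rw [← ENNReal.ofReal_mul (by positivity)]
  refine ENNReal.ofReal_le_ofReal ?_
  rw [Real.sqrt_mul (γ.trProd_nonneg hi hlt hr), e, abs_div, abs_div, abs_mul,
    abs_of_nonneg (Real.sqrt_nonneg _), abs_of_pos (by norm_num : (0 : ℝ) < 2),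
    abs_of_nonneg (Real.sqrt_nonneg _)]
  have := γ.abs_trace_le hi hlt hr
  calc _ ≤ √(gram (γ.curve r)).det * (√n * √(trProd (γ.curve r) (γ.vel i r) (γ.vel i r))) / 2 /
        √(gram g).det := by
        gcongr
    _ = _ := by ring

/-- The `θ`-speed times `√det g` equals `(det a)^{1/4}` times the amplitude integrand, and the
fourth root along the path is at most its initial value plus `√n/4` times the amplitude. Finiteness
of the amplitude lets this bound be pulled out of the integral. -/
theorem length_mul_sqrt_det_le {g : TwoForm n M x} (hg : 0 < (gram g).det)
    (hγ : γ.amplitude ≠ ⊤) :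
    ENNReal.ofReal √(gram g).det * γ.length g ≤
      (ENNReal.ofReal √√(gram a₀).det + ENNReal.ofReal (√n / 4) * γ.amplitude) * γ.amplitude := by
  have hK : ENNReal.ofReal √√(gram a₀).det + ENNReal.ofReal (√n / 4) * γ.amplitude ≠ ⊤ :=
    ENNReal.add_ne_top.2 ⟨ENNReal.ofReal_ne_top, ENNReal.mul_ne_top ENNReal.ofReal_ne_top hγ⟩
  rw [length, ← sum_lintegral_const_mul ENNReal.ofReal_ne_top]
  refine le_of_le_of_eq ?_ (sum_lintegral_const_mul hK)
  refine sum_lintegral_Icc_mono fun i hi hlt r hr => ?_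
  have hQ := γ.trProd_nonneg hi hlt hr
  have hd := (γ.posDef_gram_curve (γ.Icc_subset hi hr)).det_pos
  have e : √(gram g).det * √(trProd (γ.curve r) (γ.vel i r) (γ.vel i r) * relDet g (γ.curve r)) =
      √√(gram (γ.curve r)).det *
        √(trProd (γ.curve r) (γ.vel i r) (γ.vel i r) * √(gram (γ.curve r)).det) := by
    rw [relDet_eq, Real.sqrt_mul hQ, Real.sqrt_mul hQ, Real.sqrt_div' _ hg.le]
    have h1 := Real.mul_self_sqrt (Real.sqrt_nonneg (gram (γ.curve r)).det)
    have h2 := Real.sqrt_pos.2 hg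
    field_simp
    linear_combination -√(trProd (γ.curve r) (γ.vel i r) (γ.vel i r)) * h1
  rw [← ENNReal.ofReal_mul (Real.sqrt_nonneg _), e, ENNReal.ofReal_mul (Real.sqrt_nonneg _)]
  gcongr
  calc ENNReal.ofReal √√(gram (γ.curve r)).det
      ≤ ENNReal.ofReal (√√(gram a₀).det + |√√(gram (γ.curve r)).det - √√(gram a₀).det|) :=
        ENNReal.ofReal_le_ofReal (sub_le_iff_le_add'.1 (le_abs_self _))
    _ = ENNReal.ofReal √√(gram a₀).det +
        ENNReal.ofReal |√√(gram (γ.curve r)).det - √√(gram a₀).det| :=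
        ENNReal.ofReal_add (Real.sqrt_nonneg _) (abs_nonneg _)
    _ ≤ _ := by
        gcongr
        exact γ.ofReal_abs_sub_sqrt_sqrt_det_le (γ.Icc_subset hi hr)

/-- The logarithmic derivative `h(v,v)/a(v,v)` is at most `√tr_a(h²)`. The `θ`-speed carries an
extra factor `√det(g⁻¹a) ≥ √δ`, which costs `1/√δ`. -/
theorem ofReal_abs_log_sub_le {g : TwoForm n M x} {δ : ℝ} (hδ : 0 < δ)
    (h : ∀ s ∈ Icc (γ.t 0) (γ.t γ.pieces), δ ≤ relDet g (γ.curve s))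
    {v : TangentSpace (𝓡 n) x} (hv : v ≠ 0) :
    ENNReal.ofReal |Real.log (a₁ v v) - Real.log (a₀ v v)| ≤
      ENNReal.ofReal (1 / √δ) * γ.length g := by
  have hpos : ∀ s ∈ Icc (γ.t 0) (γ.t γ.pieces), 0 < γ.curve s v v := fun s hs =>
    γ.posDef s hs v hv
  have hd := ofReal_abs_sub_le_sum_lintegral (f := fun s => Real.log (γ.curve s v v))
    (f' := fun i s => γ.vel i s v v / γ.curve s v v) γ.monotone
    (fun i hi r hr => (γ.hasDeriv i hi r hr v v).log (hpos r (γ.Icc_subset hi hr)).ne')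
    (fun i hi => (γ.continuous_vel i hi v v).div
      (fun r hr => (γ.hasDeriv i hi r hr v v).continuousWithinAt)
      fun r hr => (hpos r (γ.Icc_subset hi hr)).ne') γ.right_mem
  rw [γ.source_eq, γ.target_eq] at hd
  refine hd.trans ?_
  rw [length, ← sum_lintegral_const_mul ENNReal.ofReal_ne_top]
  refine sum_lintegral_Icc_mono fun i hi hlt r hr => ?_
  rw [← ENNReal.ofReal_mul (by positivity)]
  refine ENNReal.ofReal_le_ofReal ?_
  have hr' := γ.Icc_subset hi hr
  have hp := hpos r hr'
  have h1 := abs_apply_le (γ.symm r hr') (γ.posDef r hr') (γ.vel_symm hi hlt hr) v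
  rw [Real.sqrt_mul (γ.trProd_nonneg hi hlt hr), abs_div, abs_of_pos hp, div_le_iff₀ hp]
  have h2 : 1 ≤ 1 / √δ * √(relDet g (γ.curve r)) := by
    rw [one_div, inv_mul_eq_div, one_le_div (Real.sqrt_pos.2 hδ)]
    exact Real.sqrt_le_sqrt (h r hr')
  have h3 : 0 ≤ γ.curve r v v * √(trProd (γ.curve r) (γ.vel i r) (γ.vel i r)) := by positivity
  calc _ ≤ γ.curve r v v * √(trProd (γ.curve r) (γ.vel i r) (γ.vel i r)) * 1 := by
        rw [mul_one]; exact h1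
    _ ≤ γ.curve r v v * √(trProd (γ.curve r) (γ.vel i r) (γ.vel i r)) *
        (1 / √δ * √(relDet g (γ.curve r))) := mul_le_mul_of_nonneg_left h2 h3
    _ = _ := by ring

end FiberPath

end Fiber

/-! ### Reversal, translation and concatenation of paths; `θ` as a distance -/

theorem setLIntegral_Icc_sub (F : ℝ → ℝ≥0∞) (a b τ : ℝ) :
    ∫⁻ s in Icc (a + τ) (b + τ), F (s - τ) = ∫⁻ s in Icc a b, F s := by
  rw [← lintegral_indicator measurableSet_Icc, ← lintegral_indicator measurableSet_Icc,
    ← lintegral_sub_right_eq_self ((Icc a b).indicator F) τ]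
  refine lintegral_congr fun s => ?_
  by_cases h : s - τ ∈ Icc a b
  · rw [indicator_of_mem h, indicator_of_mem]
    exact ⟨by linarith [h.1], by linarith [h.2]⟩
  · rw [indicator_of_notMem h, indicator_of_notMem]
    exact fun h' => h ⟨by linarith [h'.1], by linarith [h'.2]⟩

theorem setLIntegral_Icc_neg (F : ℝ → ℝ≥0∞) (a b : ℝ) :
    ∫⁻ s in Icc (-b) (-a), F (-s) = ∫⁻ s in Icc a b, F s := by
  rw [← lintegral_indicator measurableSet_Icc, ← lintegral_indicator measurableSet_Icc,
    ← lintegral_neg_eq_self ((Icc a b).indicator F)]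
  refine lintegral_congr fun s => ?_
  by_cases h : -s ∈ Icc a b
  · rw [indicator_of_mem h, indicator_of_mem]
    exact ⟨by linarith [h.2], by linarith [h.1]⟩
  · rw [indicator_of_notMem h, indicator_of_notMem]
    exact fun h' => h ⟨by linarith [h'.2], by linarith [h'.1]⟩

section Fiber

variable {n : ℕ} {M : Type u} [TopologicalSpace M] [ChartedSpace (EuclideanSpace ℝ (Fin n)) M]
  [IsManifold (𝓡 n) ∞ M] [MeasurableSpace M] [BorelSpace M] [CompactSpace M]

namespace FiberPath

variable {x : M} {a₀ a₁ a₂ : TwoForm n M x}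

/-- The constant path. -/
noncomputable def refl (a : TwoForm n M x) (ha : ∀ v w, a v w = a w v) (hp : IsPosDef a) :
    FiberPath a a where
  pieces := 0
  t _ := 0
  monotone := monotone_const
  curve _ := a
  vel _ _ := 0
  source_eq := rfl
  target_eq := rfl
  symm _ _ := ha
  posDef _ _ := hp
  hasDeriv _ h := absurd h (Nat.not_lt_zero _)
  continuous_vel _ h := absurd h (Nat.not_lt_zero _)

/-- The path run backwards. -/
noncomputable def reverse (γ : FiberPath a₀ a₁) : FiberPath a₁ a₀ where
  pieces := γ.pieces
  t i := -γ.t (γ.pieces - i)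
  monotone i j h := neg_le_neg (γ.monotone (Nat.sub_le_sub_left h _))
  curve s := γ.curve (-s)
  vel i s := -γ.vel (γ.pieces - (i + 1)) (-s)
  source_eq := by simpa using γ.target_eq
  target_eq := by simpa using γ.source_eq
  symm s hs := γ.symm (-s) ⟨by simpa using neg_le_neg hs.2, by simpa using neg_le_neg hs.1⟩
  posDef s hs := γ.posDef (-s) ⟨by simpa using neg_le_neg hs.2, by simpa using neg_le_neg hs.1⟩
  hasDeriv i hi s hs v w := by
    -- Piece `i` of the reversed path is piece `pieces - (i + 1)` of the original, whose right end
    -- has index `pieces - i`.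
    have e : γ.pieces - i = γ.pieces - (i + 1) + 1 := by omega
    have hmaps : MapsTo (fun r : ℝ => -r) (Icc (-γ.t (γ.pieces - i)) (-γ.t (γ.pieces - (i + 1))))
        (Icc (γ.t (γ.pieces - (i + 1))) (γ.t (γ.pieces - (i + 1) + 1))) := by
      rw [← e]
      exact fun r hr => ⟨by linarith [hr.2], by linarith [hr.1]⟩
    have h := γ.hasDeriv (γ.pieces - (i + 1)) (by omega) (-s) (hmaps hs) v w
    have h2 := HasDerivWithinAt.comp s h (hasDerivAt_neg s).hasDerivWithinAt hmaps
    simpa [Function.comp_def] using h2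
  continuous_vel i hi v w := by
    have e : γ.pieces - i = γ.pieces - (i + 1) + 1 := by omega
    have hmaps : MapsTo (fun r : ℝ => -r) (Icc (-γ.t (γ.pieces - i)) (-γ.t (γ.pieces - (i + 1))))
        (Icc (γ.t (γ.pieces - (i + 1))) (γ.t (γ.pieces - (i + 1) + 1))) := by
      rw [← e]
      exact fun r hr => ⟨by linarith [hr.2], by linarith [hr.1]⟩
    exact ((γ.continuous_vel (γ.pieces - (i + 1)) (by omega) v w).comp continuousOn_neg hmaps).neg

theorem trProd_neg_neg (a h : TwoForm n M x) : trProd a (-h) (-h) = trProd a h h := by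
  have : gram (-h) = -gram h := rfl
  simp [trProd, this]

theorem length_reverse (g : TwoForm n M x) (γ : FiberPath a₀ a₁) :
    γ.reverse.length g = γ.length g := by
  rw [length, length, ← Finset.sum_range_reflect]
  refine Finset.sum_congr rfl fun i hi => ?_
  have hi' := Finset.mem_range.1 hi
  have e1 : γ.pieces - (γ.pieces - 1 - i) = i + 1 := by omega
  have e2 : γ.pieces - (γ.pieces - 1 - i + 1) = i := by omega
  simp only [reverse, trProd_neg_neg, e1, e2]
  exact setLIntegral_Icc_neg (fun s => ENNReal.ofReal
    √(trProd (γ.curve s) (γ.vel i s) (γ.vel i s) * relDet g (γ.curve s))) _ _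

/-- A reparametrization by a translation of the parameter. -/
noncomputable def shift (τ : ℝ) (γ : FiberPath a₀ a₁) : FiberPath a₀ a₁ where
  pieces := γ.pieces
  t i := γ.t i + τ
  monotone i j h := by simpa using γ.monotone h
  curve s := γ.curve (s - τ)
  vel i s := γ.vel i (s - τ)
  source_eq := by simpa using γ.source_eq
  target_eq := by simpa using γ.target_eq
  symm s hs := γ.symm _ ⟨by linarith [hs.1], by linarith [hs.2]⟩
  posDef s hs := γ.posDef _ ⟨by linarith [hs.1], by linarith [hs.2]⟩
  hasDeriv i hi s hs v w := by
    have hmaps : MapsTo (fun r : ℝ => r - τ) (Icc (γ.t i + τ) (γ.t (i + 1) + τ))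
        (Icc (γ.t i) (γ.t (i + 1))) :=
      fun r hr => ⟨by linarith [hr.1], by linarith [hr.2]⟩
    have h2 := HasDerivWithinAt.comp s (γ.hasDeriv i hi (s - τ) (hmaps hs) v w)
      ((hasDerivAt_id s).sub_const τ).hasDerivWithinAt hmaps
    simpa [Function.comp_def] using h2
  continuous_vel i hi v w := by
    have hmaps : MapsTo (fun r : ℝ => r - τ) (Icc (γ.t i + τ) (γ.t (i + 1) + τ))
        (Icc (γ.t i) (γ.t (i + 1))) :=
      fun r hr => ⟨by linarith [hr.1], by linarith [hr.2]⟩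
    exact (γ.continuous_vel i hi v w).comp (continuousOn_id.sub continuousOn_const) hmaps

theorem shift_t (τ : ℝ) (γ : FiberPath a₀ a₁) (i : ℕ) : (γ.shift τ).t i = γ.t i + τ := rfl

theorem length_shift (g : TwoForm n M x) (τ : ℝ) (γ : FiberPath a₀ a₁) :
    (γ.shift τ).length g = γ.length g :=
  Finset.sum_congr rfl fun i _ => setLIntegral_Icc_sub (fun s => ENNReal.ofReal
    √(trProd (γ.curve s) (γ.vel i s) (γ.vel i s) * relDet g (γ.curve s))) _ _ _

section Trans

variable (γ₁ : FiberPath a₀ a₁) (γ₂ : FiberPath a₁ a₂) (h : γ₂.t 0 = γ₁.t γ₁.pieces)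

/-- The partition of the concatenation of two paths. -/
def transPartition (i : ℕ) : ℝ := if i ≤ γ₁.pieces then γ₁.t i else γ₂.t (i - γ₁.pieces)

/-- The curve of the concatenation of two paths. -/
noncomputable def transCurve (s : ℝ) : TwoForm n M x :=
  if s ≤ γ₁.t γ₁.pieces then γ₁.curve s else γ₂.curve s

/-- The velocity of the concatenation of two paths. -/
noncomputable def transVel (i : ℕ) (s : ℝ) : TwoForm n M x :=
  if i < γ₁.pieces then γ₁.vel i s else γ₂.vel (i - γ₁.pieces) s

theorem transPartition_left {i : ℕ} (hi : i ≤ γ₁.pieces) : γ₁.transPartition γ₂ i = γ₁.t i :=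
  if_pos hi

include h in
theorem transPartition_right (j : ℕ) : γ₁.transPartition γ₂ (γ₁.pieces + j) = γ₂.t j := by
  rcases j.eq_zero_or_pos with rfl | hj
  · rw [Nat.add_zero, transPartition_left _ _ le_rfl, h]
  · rw [transPartition, if_neg (by omega), Nat.add_sub_cancel_left]

theorem transCurve_left {s : ℝ} (hs : s ≤ γ₁.t γ₁.pieces) : γ₁.transCurve γ₂ s = γ₁.curve s :=
  if_pos hs

include h in
theorem transCurve_right {s : ℝ} (hs : γ₁.t γ₁.pieces ≤ s) :
    γ₁.transCurve γ₂ s = γ₂.curve s := by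
  rcases hs.eq_or_lt with rfl | hs
  · rw [transCurve_left _ _ le_rfl, γ₁.target_eq, ← h, γ₂.source_eq]
  · exact if_neg (not_le.2 hs)

theorem transVel_left {i : ℕ} (hi : i < γ₁.pieces) (s : ℝ) :
    γ₁.transVel γ₂ i s = γ₁.vel i s :=
  if_pos hi

theorem transVel_right (j : ℕ) (s : ℝ) : γ₁.transVel γ₂ (γ₁.pieces + j) s = γ₂.vel j s := by
  rw [transVel, if_neg (by omega), Nat.add_sub_cancel_left]

/-- The concatenation of two paths. -/
noncomputable def trans : FiberPath a₀ a₂ where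
  pieces := γ₁.pieces + γ₂.pieces
  t := γ₁.transPartition γ₂
  monotone := by
    refine monotone_nat_of_le_succ fun i => ?_
    rcases lt_or_ge i γ₁.pieces with hi | hi
    · rw [transPartition_left _ _ hi.le, transPartition_left _ _ hi]
      exact γ₁.monotone i.le_succ
    · obtain ⟨j, rfl⟩ := Nat.exists_eq_add_of_le hi
      rw [transPartition_right _ _ h, Nat.add_assoc, transPartition_right _ _ h]
      exact γ₂.monotone j.le_succ
  curve := γ₁.transCurve γ₂
  vel := γ₁.transVel γ₂
  source_eq := by
    rw [transPartition_left _ _ (Nat.zero_le _),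
      transCurve_left _ _ (γ₁.monotone (Nat.zero_le _)), γ₁.source_eq]
  target_eq := by
    rw [transPartition_right _ _ h,
      transCurve_right _ _ h (h ▸ γ₂.monotone (Nat.zero_le _)), γ₂.target_eq]
  symm s hs v w := by
    rw [transPartition_left _ _ (Nat.zero_le _), transPartition_right _ _ h] at hs
    rcases le_total s (γ₁.t γ₁.pieces) with hle | hle
    · rw [transCurve_left _ _ hle]
      exact γ₁.symm s ⟨hs.1, hle⟩ v w
    · rw [transCurve_right _ _ h hle]
      exact γ₂.symm s ⟨h ▸ hle, hs.2⟩ v w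
  posDef s hs := by
    rw [transPartition_left _ _ (Nat.zero_le _), transPartition_right _ _ h] at hs
    rcases le_total s (γ₁.t γ₁.pieces) with hle | hle
    · rw [transCurve_left _ _ hle]
      exact γ₁.posDef s ⟨hs.1, hle⟩
    · rw [transCurve_right _ _ h hle]
      exact γ₂.posDef s ⟨h ▸ hle, hs.2⟩
  hasDeriv i hi s hs v w := by
    rcases lt_or_ge i γ₁.pieces with hi' | hi'
    · rw [transPartition_left _ _ hi'.le, transPartition_left _ _ hi'] at hs ⊢
      rw [transVel_left _ _ hi']
      have hle : ∀ r ∈ Icc (γ₁.t i) (γ₁.t (i + 1)), r ≤ γ₁.t γ₁.pieces := fun r hr =>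
        hr.2.trans (γ₁.monotone hi')
      refine (γ₁.hasDeriv i hi' s hs v w).congr (fun r hr => ?_) ?_
      · rw [transCurve_left _ _ (hle r hr)]
      · rw [transCurve_left _ _ (hle s hs)]
    · obtain ⟨j, rfl⟩ := Nat.exists_eq_add_of_le hi'
      rw [Nat.add_assoc, transPartition_right _ _ h, transPartition_right _ _ h] at hs
      rw [transVel_right, Nat.add_assoc, transPartition_right _ _ h, transPartition_right _ _ h]
      have hle : ∀ r ∈ Icc (γ₂.t j) (γ₂.t (j + 1)), γ₁.t γ₁.pieces ≤ r := fun r hr =>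
        h ▸ (γ₂.monotone j.zero_le).trans hr.1
      refine (γ₂.hasDeriv j (by omega) s hs v w).congr (fun r hr => ?_) ?_
      · rw [transCurve_right _ _ h (hle r hr)]
      · rw [transCurve_right _ _ h (hle s hs)]
  continuous_vel i hi v w := by
    rcases lt_or_ge i γ₁.pieces with hi' | hi'
    · rw [transPartition_left _ _ hi'.le, transPartition_left _ _ hi']
      simp only [transVel_left _ _ hi']
      exact γ₁.continuous_vel i hi' v w
    · obtain ⟨j, rfl⟩ := Nat.exists_eq_add_of_le hi'
      simp only [transVel_right, Nat.add_assoc, transPartition_right _ _ h]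
      exact γ₂.continuous_vel j (by omega) v w

theorem length_trans (g : TwoForm n M x) :
    (γ₁.trans γ₂ h).length g = γ₁.length g + γ₂.length g := by
  change ∑ i ∈ Finset.range (γ₁.pieces + γ₂.pieces),
    ∫⁻ s in Icc (γ₁.transPartition γ₂ i) (γ₁.transPartition γ₂ (i + 1)),
      ENNReal.ofReal √(trProd (γ₁.transCurve γ₂ s) (γ₁.transVel γ₂ i s) (γ₁.transVel γ₂ i s) *
        relDet g (γ₁.transCurve γ₂ s)) = _
  rw [Finset.sum_range_add, length, length]
  congr 1
  · refine Finset.sum_congr rfl fun i hi => ?_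
    have hi' := Finset.mem_range.1 hi
    rw [transPartition_left _ _ hi'.le, transPartition_left _ _ hi']
    refine setLIntegral_congr_fun measurableSet_Icc fun s hs => ?_
    simp only [transVel_left _ _ hi', transCurve_left _ _ (hs.2.trans (γ₁.monotone hi'))]
  · refine Finset.sum_congr rfl fun j hj => ?_
    rw [Nat.add_assoc, transPartition_right _ _ h, transPartition_right _ _ h]
    refine setLIntegral_congr_fun measurableSet_Icc fun s hs => ?_
    simp only [transVel_right,
      transCurve_right _ _ h (h ▸ (γ₂.monotone j.zero_le).trans hs.1)]

end Trans

end FiberPath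

variable {x : M} {g : TwoForm n M x}

/-- The constant path has length zero. It exists only for symmetric positive definite `a`; for other
forms there is no path and the infimum is `⊤`. -/
theorem thetaDist_self {a : TwoForm n M x} (ha : ∀ v w, a v w = a w v) (hp : IsPosDef a) :
    thetaDist g a a = 0 := by
  refine le_antisymm ((iInf_le _ (FiberPath.refl a ha hp)).trans ?_) zero_le
  simp [FiberPath.length, FiberPath.refl]

theorem thetaDist_comm (a b : TwoForm n M x) : thetaDist g a b = thetaDist g b a := by
  have h : ∀ a b : TwoForm n M x, thetaDist g a b ≤ thetaDist g b a := fun a b =>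
    le_iInf fun γ => (iInf_le _ γ.reverse).trans (γ.length_reverse g).le
  exact le_antisymm (h a b) (h b a)

theorem thetaDist_triangle (a b c : TwoForm n M x) :
    thetaDist g a c ≤ thetaDist g a b + thetaDist g b c := by
  rw [thetaDist, thetaDist, thetaDist, ENNReal.iInf_add]
  refine le_iInf fun γ₁ => ?_
  rw [ENNReal.add_iInf]
  refine le_iInf fun γ₂ => ?_
  -- The second path is translated so that its parameter interval starts where the first one ends.
  refine (iInf_le _ (γ₁.trans (γ₂.shift (γ₁.t γ₁.pieces - γ₂.t 0)) 
    (by rw [FiberPath.shift_t, add_sub_cancel]))).trans ?_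
  rw [FiberPath.length_trans, FiberPath.length_shift]

theorem thetaDist_le_sum {a : ℕ → TwoForm n M x} (ha : ∀ k v w, a k v w = a k w v)
    (hp : ∀ k, IsPosDef (a k)) (k j : ℕ) :
    thetaDist g (a k) (a (k + j)) ≤
      ∑ i ∈ Finset.range j, thetaDist g (a (k + i)) (a (k + i + 1)) := by
  induction j with
  | zero => simp [thetaDist_self (ha k) (hp k)]
  | succ j ih =>
    rw [Finset.sum_range_succ]
    exact (thetaDist_triangle _ (a (k + j)) _).trans (add_le_add_left ih _)

/-- A sequence of forms is `θ`-Cauchy if the distances of consecutive members are summable. -/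
theorem thetaCauchy_of_tsum_lt_top {a : ℕ → TwoForm n M x} (ha : ∀ k v w, a k v w = a k w v)
    (hp : ∀ k, IsPosDef (a k)) (h : ∑' k, thetaDist g (a k) (a (k + 1)) ≠ ⊤) {ε : ℝ≥0∞}
    (hε : 0 < ε) : ∃ N : ℕ, ∀ k ≥ N, ∀ l ≥ N, thetaDist g (a k) (a l) < ε := by
  have h0 := ENNReal.tendsto_sum_nat_add _ h
  obtain ⟨N, hN⟩ := ((tendsto_order.1 h0).2 ε hε).exists_forall_of_atTop
  have key : ∀ k ≥ N, ∀ l ≥ k, thetaDist g (a k) (a l) < ε := by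
    intro k hk l hl
    obtain ⟨j, rfl⟩ := Nat.exists_eq_add_of_le hl
    refine (thetaDist_le_sum ha hp k j).trans_lt (lt_of_le_of_lt ?_ (hN k hk))
    refine le_trans (le_of_eq ?_) (ENNReal.sum_le_tsum (Finset.range j))
    exact Finset.sum_congr rfl fun i _ => by rw [add_comm k i]
  refine ⟨N, fun k hk l hl => ?_⟩
  rcases le_total k l with hkl | hkl
  · exact key k hk l hkl
  · rw [thetaDist_comm]
    exact key l hl k hkl

/-- A path shorter than `ε` changes `√det(g⁻¹a)` by at most `√n ε/2 ≤ √δ/2`. The relative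
determinant thus stays above `δ/4`, and `√(δ/4) = √δ/2` gives the constant `2/√δ`. -/
theorem ofReal_abs_log_sub_le_of_thetaDist_lt (hg : 0 < (gram g).det) {a b : TwoForm n M x}
    {δ ε : ℝ} (hδ : 0 < δ) (hε : √n * ε ≤ √δ) (ha : δ ≤ relDet g a)
    (h : thetaDist g a b < ENNReal.ofReal ε) {v : TangentSpace (𝓡 n) x} (hv : v ≠ 0) :
    |Real.log (b v v) - Real.log (a v v)| ≤ 2 / √δ * ε := by
  have hε0 : 0 < ε := ENNReal.ofReal_pos.1 (zero_le.trans_lt h)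
  obtain ⟨γ, hγ⟩ := iInf_lt_iff.1 h
  have hlow : ∀ s ∈ Icc (γ.t 0) (γ.t γ.pieces), δ / 4 ≤ relDet g (γ.curve s) := by
    intro s hs
    have h1 := (γ.ofReal_abs_sub_sqrt_relDet_le hg hs).trans (mul_le_mul_right hγ.le _)
    rw [← ENNReal.ofReal_mul (by positivity), ENNReal.ofReal_le_ofReal_iff (by positivity)] at h1
    have h2 := Real.sqrt_le_sqrt ha
    have h3 : √δ / 2 ≤ √(relDet g (γ.curve s)) := by
      have := (abs_le.1 h1).1
      linarith
    have h4 : 0 < √(relDet g (γ.curve s)) := lt_of_lt_of_le (by positivity) h3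
    have h5 := Real.sq_sqrt (Real.sqrt_pos.1 h4).le
    have h6 := Real.sq_sqrt hδ.le
    nlinarith [Real.sqrt_nonneg δ]
  have h1 := (γ.ofReal_abs_log_sub_le (by positivity) hlow hv).trans (mul_le_mul_right hγ.le _)
  rw [← ENNReal.ofReal_mul (by positivity), ENNReal.ofReal_le_ofReal_iff (by positivity)] at h1
  have e : √(δ / 4) = √δ / 2 := by
    rw [Real.sqrt_div' _ (by norm_num), show (4 : ℝ) = 2 ^ 2 by norm_num,
      Real.sqrt_sq (by norm_num)]
  rwa [e, one_div_div] at h1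

/-- A `θ`-Cauchy sequence of positive definite forms whose determinants are bounded below
converges. -/
theorem exists_tendsto_of_thetaCauchy (hg : 0 < (gram g).det) {a : ℕ → TwoForm n M x}
    (ha : ∀ k v w, a k v w = a k w v) (hp : ∀ k, IsPosDef (a k))
    (hc : ∀ ε : ℝ≥0∞, 0 < ε → ∃ N : ℕ, ∀ k ≥ N, ∀ l ≥ N, thetaDist g (a k) (a l) < ε)
    {δ : ℝ} (hδ : 0 < δ) (hlow : ∀ k, δ ≤ relDet g (a k)) :
    ∃ B : TwoForm n M x, Tendsto a atTop (𝓝 B) := by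
  have hdiag : ∀ v, ∃ L : ℝ, Tendsto (fun k => a k v v) atTop (𝓝 L) := by
    intro v
    rcases eq_or_ne v 0 with rfl | hv
    · exact ⟨0, by simp⟩
    -- The logarithms are the quantities that `θ` controls; exponentiating their limit gives
    -- convergence of the diagonal values.
    have hcau : CauchySeq fun k => Real.log (a k v v) := by
      refine Metric.cauchySeq_iff.2 fun ε hε => ?_
      have hn : 0 < √n + 1 := by positivity
      have hs := Real.sqrt_pos.2 hδ
      -- The first bound keeps the determinants away from zero along short paths, the second makes
      -- the logarithms `ε/2`-close. The summand `1` avoids dividing by zero when `n = 0`.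
      set η : ℝ := min (√δ / (√n + 1)) (√δ / 2 * (ε / 2)) with hη
      have hη0 : 0 < η := lt_min (by positivity) (by positivity)
      obtain ⟨N, hN⟩ := hc (ENNReal.ofReal η) (ENNReal.ofReal_pos.2 hη0)
      refine ⟨N, fun k hk l hl => ?_⟩
      have h1 : √n * η ≤ √δ := by
        calc √n * η ≤ (√n + 1) * (√δ / (√n + 1)) := by
              gcongr
              · linarith
              · exact min_le_left _ _
          _ = √δ := by field_simp
      have h2 := ofReal_abs_log_sub_le_of_thetaDist_lt hg hδ h1 (hlow l) (hN l hl k hk) hv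
      rw [Real.dist_eq]
      refine h2.trans_lt ?_
      calc 2 / √δ * η ≤ 2 / √δ * (√δ / 2 * (ε / 2)) := by
            gcongr
            exact min_le_right _ _
        _ = ε / 2 := by field_simp
        _ < ε := half_lt_self hε
    obtain ⟨L, hL⟩ := cauchySeq_tendsto_of_complete hcau
    refine ⟨Real.exp L, ((Real.continuous_exp.tendsto L).comp hL).congr fun k => ?_⟩
    exact Real.exp_log (hp k v hv)
  -- Polarization recovers all values from the diagonal ones.
  refine exists_tendsto_twoForm fun v w => ?_
  obtain ⟨L₁, h₁⟩ := hdiag (v + w)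
  obtain ⟨L₂, h₂⟩ := hdiag v
  obtain ⟨L₃, h₃⟩ := hdiag w
  refine ⟨(L₁ - L₂ - L₃) / 2, (((h₁.sub h₂).sub h₃).div_const 2).congr fun k => ?_⟩
  simp only [map_add, _root_.add_apply, ha k w v]
  ring

end Fiber

/-! ### Continuity of coefficients, changes of chart and coordinate measure -/

section Coordinates

variable {n : ℕ} {M : Type u} [TopologicalSpace M] [ChartedSpace (EuclideanSpace ℝ (Fin n)) M]
  [IsManifold (𝓡 n) ∞ M]

theorem isManifold_one : IsManifold (𝓡 n) 1 M := IsManifold.of_le (n := ∞) (by simp)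

/-- In the trivialization that defines it, the field is a constant vector. -/
theorem contMDiffOn_coordVec (c : M) (i : Fin n) :
    ContMDiffOn (𝓡 n) ((𝓡 n).prod (𝓡 n)) 0
      (fun x : M => Bundle.TotalSpace.mk' (EuclideanSpace ℝ (Fin n))
        (E := fun y : M => TangentSpace (𝓡 n) y) x (coordVec c x i))
      (chartAt (EuclideanSpace ℝ (Fin n)) c).source := by
  have := isManifold_one (n := n) (M := M)
  have : IsManifold (𝓡 n) (0 + 1) M := by rwa [zero_add]
  have : ContMDiffVectorBundle 0 (EuclideanSpace ℝ (Fin n)) (fun y : M => TangentSpace (𝓡 n) y)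
    (𝓡 n) := TangentBundle.contMDiffVectorBundle
  have hb : (trivializationAt (EuclideanSpace ℝ (Fin n))
      (fun y : M => TangentSpace (𝓡 n) y) c).baseSet =
      (chartAt (EuclideanSpace ℝ (Fin n)) c).source := by simp
  rw [← hb, Bundle.Trivialization.contMDiffOn_section_baseSet_iff]
  refine (contMDiffOn_const (c := EuclideanSpace.single i (1 : ℝ))).congr fun y hy => ?_
  rw [coordVec, Bundle.Trivialization.symmL_apply _ hy]
  exact congrArg Prod.snd (Bundle.Trivialization.apply_mk_symm _ hy _)

/-- The coefficients of a smooth tensor field are continuous. -/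
theorem continuousOn_gramIn {B : TensorField n M}
    (hB : ContMDiff (𝓡 n)
      ((𝓡 n).prod 𝓘(ℝ, EuclideanSpace ℝ (Fin n) →L[ℝ] EuclideanSpace ℝ (Fin n) →L[ℝ] ℝ)) ∞
      (fun x : M => Bundle.TotalSpace.mk'
        (EuclideanSpace ℝ (Fin n) →L[ℝ] EuclideanSpace ℝ (Fin n) →L[ℝ] ℝ)
        (E := fun x : M => TwoForm n M x) x (B x))) (c : M) (i j : Fin n) :
    ContinuousOn (fun x => gramIn c (B x) i j)
      (chartAt (EuclideanSpace ℝ (Fin n)) c).source := by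
  have := isManifold_one (n := n) (M := M)
  have h := ContMDiffOn.clm_bundle_apply₂ (F₁ := EuclideanSpace ℝ (Fin n))
    (F₂ := EuclideanSpace ℝ (Fin n)) (F₃ := ℝ) (E₁ := fun y : M => TangentSpace (𝓡 n) y)
    (E₂ := fun y : M => TangentSpace (𝓡 n) y) (E₃ := fun _ : M => ℝ)
    (n := 0) (b := fun x => x) (ψ := B) (s := (chartAt (EuclideanSpace ℝ (Fin n)) c).source)
    (IB := 𝓡 n) (IM := 𝓡 n) (hB.of_le (by simp)).contMDiffOn (contMDiffOn_coordVec c i)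
    (contMDiffOn_coordVec c j)
  intro x hx
  have h2 := (Bundle.contMDiffWithinAt_section (F := ℝ) (E := fun _ : M => ℝ)).1 (h x hx)
  exact h2.continuousWithinAt

end Coordinates

section Coordinates

variable {n : ℕ} {M : Type u} [TopologicalSpace M] [ChartedSpace (EuclideanSpace ℝ (Fin n)) M]
  [IsManifold (𝓡 n) ∞ M]

/-- The derivative at `x` of the change of coordinates from the chart around `c` to the chart
around `c'`. -/
noncomputable def coordDeriv (c c' x : M) :
    EuclideanSpace ℝ (Fin n) →L[ℝ] EuclideanSpace ℝ (Fin n) :=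
  haveI : IsManifold (𝓡 n) 1 M := isManifold_one
  tangentCoordChange (𝓡 n) c c' x

theorem hasFDerivAt_coordChange {c c' x : M}
    (hx : x ∈ (chartAt (EuclideanSpace ℝ (Fin n)) c).source)
    (hx' : x ∈ (chartAt (EuclideanSpace ℝ (Fin n)) c').source) :
    HasFDerivAt (chartAt (EuclideanSpace ℝ (Fin n)) c' ∘
      (chartAt (EuclideanSpace ℝ (Fin n)) c).symm) (coordDeriv c c' x)
      (chartAt (EuclideanSpace ℝ (Fin n)) c x) := by
  have : IsManifold (𝓡 n) 1 M := isManifold_one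
  have h := hasFDerivWithinAt_tangentCoordChange (I := 𝓡 n) (x := c) (y := c') (z := x)
    (by simpa using ⟨hx, hx'⟩)
  rw [← coordDeriv] at h
  simpa using h

/-- The cocycle identity for the coordinate changes of the tangent bundle, with the intermediate
vector expanded in the standard basis. -/
theorem coordVec_eq_sum {c c' x : M}
    (hx : x ∈ (chartAt (EuclideanSpace ℝ (Fin n)) c).source)
    (hx' : x ∈ (chartAt (EuclideanSpace ℝ (Fin n)) c').source) (i : Fin n) :
    coordVec c x i =
      ∑ j, coordDeriv c c' x (EuclideanSpace.single i (1 : ℝ)) j • coordVec c' x j := by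
  have : IsManifold (𝓡 n) 1 M := isManifold_one
  have h := tangentCoordChange_comp (I := 𝓡 n) (w := c) (x := c') (y := x) (z := x)
    (v := EuclideanSpace.single i (1 : ℝ)) (by simpa using ⟨hx, hx'⟩)
  have e : ∀ {b : M} (_ : x ∈ (chartAt (EuclideanSpace ℝ (Fin n)) b).source)
      (v : EuclideanSpace ℝ (Fin n)),
      (trivializationAt (EuclideanSpace ℝ (Fin n)) (fun y : M => TangentSpace (𝓡 n) y) b).symmL
        ℝ x v = tangentCoordChange (𝓡 n) b x x v := fun hb v => by
    rw [TangentBundle.symmL_trivializationAt_eq_core hb]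
    rfl
  simp only [coordVec]
  rw [e hx, ← h, ← e hx', ← coordDeriv]
  set w := coordDeriv c c' x (EuclideanSpace.single i (1 : ℝ)) with hw
  have hsum : w = ∑ j, w j • EuclideanSpace.single j (1 : ℝ) := by
    simpa using ((EuclideanSpace.basisFun (Fin n) ℝ).sum_repr w).symm
  conv_lhs => rw [hsum]
  simp only [map_sum, map_smul]

/-- The matrix of a form transforms by congruence with the Jacobian, so `√det` compensates the
Jacobian factor in a change of variables. -/
theorem gramIn_coordChange {c c' x : M}
    (hx : x ∈ (chartAt (EuclideanSpace ℝ (Fin n)) c).source)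
    (hx' : x ∈ (chartAt (EuclideanSpace ℝ (Fin n)) c').source) (B : TwoForm n M x) :
    (gramIn c B).det = (coordDeriv (n := n) c c' x).det ^ 2 * (gramIn c' B).det := by
  let J : Matrix (Fin n) (Fin n) ℝ := LinearMap.toMatrix (EuclideanSpace.basisFun (Fin n) ℝ).toBasis
    (EuclideanSpace.basisFun (Fin n) ℝ).toBasis (coordDeriv (n := n) c c' x : _ →ₗ[ℝ] _)
  have hJ : ∀ i j, J j i = coordDeriv (n := n) c c' x (EuclideanSpace.single i (1 : ℝ)) j := by
    intro i j
    simp [J, LinearMap.toMatrix_apply]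
  have hdet : J.det = (coordDeriv (n := n) c c' x).det := LinearMap.det_toMatrix _ _
  have h : gramIn c B = J.transpose * gramIn c' B * J := by
    ext i j
    simp only [gramIn_apply, coordVec_eq_sum (n := n) hx hx', map_sum, map_smul, _root_.sum_apply,
      _root_.smul_apply, smul_eq_mul, Matrix.mul_apply, Matrix.transpose_apply, hJ,
      Finset.sum_mul]
    refine Finset.sum_congr rfl fun k _ => ?_
    first
      | exact Finset.sum_congr rfl fun l _ => by ring
      | (rw [Finset.mul_sum]; exact Finset.sum_congr rfl fun l _ => by ring)
  rw [h, Matrix.det_mul, Matrix.det_mul, Matrix.det_transpose, hdet]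
  ring

theorem continuousOn_coeff {B : TensorField n M}
    (hB : ∀ c i j, ContinuousOn (fun x => gramIn c (B x) i j)
      (chartAt (EuclideanSpace ℝ (Fin n)) c).source) (c : M) (i j : Fin n) :
    ContinuousOn (coeff B c i j) (chartAt (EuclideanSpace ℝ (Fin n)) c).target :=
  (hB c i j).comp (chartAt (EuclideanSpace ℝ (Fin n)) c).continuousOn_symm
    (chartAt (EuclideanSpace ℝ (Fin n)) c).mapsTo_symm

theorem coeff_apply_chart (B : TensorField n M) {c x : M}
    (hx : x ∈ (chartAt (EuclideanSpace ℝ (Fin n)) c).source) (i j : Fin n) :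
    coeff B c i j (chartAt (EuclideanSpace ℝ (Fin n)) c x) = gramIn c (B x) i j := by
  rw [coeff, (chartAt (EuclideanSpace ℝ (Fin n)) c).left_inv hx]

variable [MeasurableSpace M] [BorelSpace M]

theorem measurableSet_chart_image {c : M} {S : Set M} (hS : MeasurableSet S)
    (hsub : S ⊆ (chartAt (EuclideanSpace ℝ (Fin n)) c).source) :
    MeasurableSet (chartAt (EuclideanSpace ℝ (Fin n)) c '' S) := by
  classical
  rw [(chartAt (EuclideanSpace ℝ (Fin n)) c).image_eq_target_inter_inv_preimage hsub]
  have ho := (chartAt (EuclideanSpace ℝ (Fin n)) c).open_target.measurableSet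
  -- The inverse chart is extended by a constant to a globally measurable map; only its values on
  -- the target matter.
  have hm : Measurable ((chartAt (EuclideanSpace ℝ (Fin n)) c).target.piecewise
      (chartAt (EuclideanSpace ℝ (Fin n)) c).symm fun _ => c) :=
    (chartAt (EuclideanSpace ℝ (Fin n)) c).continuousOn_symm.measurable_piecewise
      continuousOn_const ho
  convert ho.inter (hm hS) using 1
  ext y
  by_cases hy : y ∈ (chartAt (EuclideanSpace ℝ (Fin n)) c).target <;> simp [hy]

variable [CompactSpace M]

/-- The `k`-th chart of the atlas `coords`. -/
noncomputable abbrev coordChart (n : ℕ) (M : Type u) [TopologicalSpace M]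
    [ChartedSpace (EuclideanSpace ℝ (Fin n)) M] [MeasurableSpace M] [BorelSpace M]
    [CompactSpace M] (k : Fin (coords n M).card) :
    OpenPartialHomeomorph M (EuclideanSpace ℝ (Fin n)) :=
  chartAt (EuclideanSpace ℝ (Fin n)) ((coords n M).center k)

/-- The `k`-th piece of the partition `coords`. -/
abbrev coordPiece (n : ℕ) (M : Type u) [TopologicalSpace M]
    [ChartedSpace (EuclideanSpace ℝ (Fin n)) M] [MeasurableSpace M] [BorelSpace M]
    [CompactSpace M] (k : Fin (coords n M).card) : Set M :=
  {x | (coords n M).index x = k}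

theorem measurableSet_coordPiece (k : Fin (coords n M).card) :
    MeasurableSet (coordPiece n M k) :=
  (coords n M).measurableSet_piece k

theorem coordPiece_subset (k : Fin (coords n M).card) :
    coordPiece n M k ⊆ (coordChart n M k).source := by
  rintro x rfl
  exact (coords n M).mem_source x

theorem gram_eq_gramIn {k : Fin (coords n M).card} {x : M} (hx : x ∈ coordPiece n M k)
    (B : TwoForm n M x) : gram B = gramIn ((coords n M).center k) B := by
  have hx : (coords n M).index x = k := hx
  rw [gram, hx]

theorem measurable_of_coordPiece {f : M → ℝ} {F : Fin (coords n M).card → M → ℝ}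
    (hF : ∀ k, ContinuousOn (F k) (coordChart n M k).source)
    (h : ∀ k, ∀ x ∈ coordPiece n M k, f x = F k x) : Measurable f := by
  refine measurable_of_isOpen fun U hU => ?_
  have : f ⁻¹' U = ⋃ k, coordPiece n M k ∩ ((coordChart n M k).source ∩ F k ⁻¹' U) := by
    ext x
    simp only [mem_iUnion, mem_inter_iff, mem_preimage]
    constructor
    · intro hx
      refine ⟨(coords n M).index x, rfl, coordPiece_subset _ rfl, ?_⟩
      rwa [← h _ x rfl]
    · rintro ⟨k, hk, -, hx⟩
      rwa [h k x hk]
  rw [this]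
  exact MeasurableSet.iUnion fun k => (measurableSet_coordPiece k).inter
    ((hF k).isOpen_inter_preimage (coordChart n M k).open_source hU).measurableSet

theorem measurable_gram_apply {B : TensorField n M}
    (hB : ∀ c i j, ContinuousOn (fun x => gramIn c (B x) i j)
      (chartAt (EuclideanSpace ℝ (Fin n)) c).source) (i j : Fin n) :
    Measurable fun x => gram (B x) i j :=
  measurable_of_coordPiece (fun k => hB _ i j) fun k x hx => by rw [gram_eq_gramIn hx]

theorem measurable_matrix_det {α ι : Type*} [MeasurableSpace α] [Fintype ι] [DecidableEq ι]
    {A : α → Matrix ι ι ℝ} (hA : ∀ i j, Measurable fun x => A x i j) :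
    Measurable fun x => (A x).det := by
  simp only [Matrix.det_apply']
  fun_prop

instance : SFinite (coordMeasure n M) := by
  unfold coordMeasure
  infer_instance

theorem aemeasurable_chart_symm (c : M) :
    AEMeasurable (chartAt (EuclideanSpace ℝ (Fin n)) c).symm
      (volume.restrict (chartAt (EuclideanSpace ℝ (Fin n)) c).target) :=
  (chartAt (EuclideanSpace ℝ (Fin n)) c).continuousOn_symm.aemeasurable
    (chartAt (EuclideanSpace ℝ (Fin n)) c).open_target.measurableSet

theorem setLIntegral_coordMeasure {f : M → ℝ≥0∞} (hf : Measurable f) {S : Set M}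
    (hS : MeasurableSet S) :
    ∫⁻ x in S, f x ∂(coordMeasure n M) = ∑ k, ∫⁻ y in coordChart n M k '' (S ∩ coordPiece n M k),
      f ((coordChart n M k).symm y) := by
  rw [coordMeasure, Measure.restrict_sum _ hS, lintegral_sum_measure, tsum_fintype]
  refine Finset.sum_congr rfl fun k _ => ?_
  have hA : MeasurableSet (S ∩ coordPiece n M k) := hS.inter (measurableSet_coordPiece k)
  have hm := aemeasurable_chart_symm (n := n) ((coords n M).center k)
  rw [Measure.restrict_restrict hS, Measure.restrict_map_of_aemeasurable hm hA,
    lintegral_map' hf.aemeasurable (hm.mono_measure Measure.restrict_le_self),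
    Measure.restrict_restrict₀ (hm.nullMeasurable hA),
    (coordChart n M k).image_eq_target_inter_inv_preimage
      (inter_subset_right.trans (coordPiece_subset k)), inter_comm]

theorem coordMeasure_apply {S : Set M} (hS : MeasurableSet S) :
    coordMeasure n M S = ∑ k, volume (coordChart n M k '' (S ∩ coordPiece n M k)) := by
  have := setLIntegral_coordMeasure (n := n) (M := M) (f := fun _ => 1) measurable_const hS
  simpa using this

/-- A nullset for the volume measures is a nullset in every chart. -/
theorem volume_chart_image_eq_zero {N : Set M} (hN : coordMeasure n M N = 0) (c : M) :
    volume (chartAt (EuclideanSpace ℝ (Fin n)) c ''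
      (N ∩ (chartAt (EuclideanSpace ℝ (Fin n)) c).source)) = 0 := by
  -- The formula for the measure requires a measurable set, so the nullset is enlarged to a
  -- measurable hull.
  have hT : coordMeasure n M (toMeasurable (coordMeasure n M) N) = 0 := by
    rw [measure_toMeasurable, hN]
  rw [coordMeasure_apply (measurableSet_toMeasurable _ _), Finset.sum_eq_zero_iff] at hT
  set e := chartAt (EuclideanSpace ℝ (Fin n)) c with he
  have hsub : e '' (N ∩ e.source) ⊆ ⋃ k, (e ∘ (coordChart n M k).symm) ''
      (coordChart n M k '' (N ∩ e.source ∩ coordPiece n M k)) := by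
    rintro _ ⟨x, hx, rfl⟩
    refine mem_iUnion.2 ⟨(coords n M).index x, coordChart n M _ x, ⟨x, ⟨hx, rfl⟩, rfl⟩, ?_⟩
    rw [Function.comp_apply, (coordChart n M _).left_inv (mem_coords_source x)]
  refine measure_mono_null hsub (measure_iUnion_null fun k => ?_)
  -- Transition maps are differentiable and hence preserve nullsets.
  refine addHaar_image_eq_zero_of_differentiableOn_of_addHaar_eq_zero _ ?_ ?_
  · rintro _ ⟨x, hx, rfl⟩
    exact (hasFDerivAt_coordChange (coordPiece_subset k hx.2)
      hx.1.2).differentiableAt.differentiableWithinAt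
  · refine measure_mono_null (image_mono ?_) (hT k (Finset.mem_univ k))
    exact inter_subset_inter_left _ (inter_subset_left.trans (subset_toMeasurable _ _))

theorem measurable_density {B : TensorField n M}
    (hB : ∀ c i j, ContinuousOn (fun x => gramIn c (B x) i j)
      (chartAt (EuclideanSpace ℝ (Fin n)) c).source) :
    Measurable fun x => ENNReal.ofReal √(gram (B x)).det :=
  (measurable_matrix_det (measurable_gram_apply hB)).sqrt.ennreal_ofReal

/-- The volume of a subset of a chart domain is at most its volume computed in this chart. -/
theorem setLIntegral_density_le {B : TensorField n M}
    (hB : ∀ c i j, ContinuousOn (fun x => gramIn c (B x) i j)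
      (chartAt (EuclideanSpace ℝ (Fin n)) c).source) {c : M} {S : Set M} (hS : MeasurableSet S)
    (hsub : S ⊆ (chartAt (EuclideanSpace ℝ (Fin n)) c).source) :
    ∫⁻ x in S, ENNReal.ofReal √(gram (B x)).det ∂(coordMeasure n M) ≤
      (coords n M).card • ∫⁻ y in chartAt (EuclideanSpace ℝ (Fin n)) c '' S,
        ENNReal.ofReal √(Matrix.of fun i j => coeff B c i j y).det := by
  set e := chartAt (EuclideanSpace ℝ (Fin n)) c with he
  rw [setLIntegral_coordMeasure (measurable_density hB) hS]
  -- Each piece is bounded by the integral over all of `S`; the resulting crude factor is harmless,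
  -- as only finiteness is wanted.
  refine (Finset.sum_le_card_nsmul _ _ _ fun k _ => ?_).trans (by rw [Finset.card_fin])
  have hAm : MeasurableSet (S ∩ coordPiece n M k) := hS.inter (measurableSet_coordPiece k)
  have himg : coordChart n M k '' (S ∩ coordPiece n M k) =
      (coordChart n M k ∘ e.symm) '' (e '' (S ∩ coordPiece n M k)) := by
    rw [← image_comp]
    refine image_congr fun x hx => ?_
    simp only [Function.comp_apply]
    rw [e.left_inv (hsub hx.1)]
  have hmem : ∀ y ∈ e '' (S ∩ coordPiece n M k), e.symm y ∈ S ∩ coordPiece n M k ∧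
      e (e.symm y) = y := by
    rintro _ ⟨x, hx, rfl⟩
    rw [e.left_inv (hsub hx.1)]
    exact ⟨hx, rfl⟩
  rw [himg, lintegral_image_eq_lintegral_abs_det_fderiv_mul volume
    (measurableSet_chart_image hAm (inter_subset_left.trans hsub))
    (f' := fun y => coordDeriv c ((coords n M).center k) (e.symm y)) ?_ ?_]
  · refine le_trans ?_ (lintegral_mono_set (image_mono (inter_subset_left (t := coordPiece n M k))))
    refine setLIntegral_mono' (measurableSet_chart_image hAm (inter_subset_left.trans hsub)) ?_
    intro y hy
    obtain ⟨hx, -⟩ := hmem y hy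
    have h1 : (coordChart n M k).symm ((coordChart n M k ∘ e.symm) y) = e.symm y :=
      (coordChart n M k).left_inv (coordPiece_subset k hx.2)
    rw [h1, ← ENNReal.ofReal_mul (abs_nonneg _), ← Real.sqrt_sq_eq_abs,
      ← Real.sqrt_mul (sq_nonneg _), gram_eq_gramIn hx.2,
      ← gramIn_coordChange (hsub hx.1) (coordPiece_subset k hx.2)]
    exact le_rfl
  · intro y hy
    obtain ⟨hx, hy'⟩ := hmem y hy
    have := hasFDerivAt_coordChange (hsub hx.1) (coordPiece_subset k hx.2)
    rw [← he, hy'] at this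
    exact this.hasFDerivWithinAt
  · intro y hy z hz hyz
    obtain ⟨hx, hy'⟩ := hmem y hy
    obtain ⟨hx', hz'⟩ := hmem z hz
    have := (coordChart n M k).injOn (coordPiece_subset k hx.2) (coordPiece_subset k hx'.2) hyz
    rw [← hy', this, hz']

/-- The total volume of a continuous tensor field is finite. -/
theorem lintegral_density_lt_top {B : TensorField n M}
    (hB : ∀ c i j, ContinuousOn (fun x => gramIn c (B x) i j)
      (chartAt (EuclideanSpace ℝ (Fin n)) c).source) :
    ∫⁻ x, ENNReal.ofReal √(gram (B x)).det ∂(coordMeasure n M) < ⊤ := by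
  rw [← setLIntegral_univ, ← withDensity_apply _ MeasurableSet.univ]
  -- By compactness it suffices that every point has a neighbourhood of finite volume: the preimage
  -- of a ball whose closure lies in the image of a chart.
  refine isCompact_univ.measure_lt_top_of_nhdsWithin fun c _ => ?_
  rw [nhdsWithin_univ]
  set e := chartAt (EuclideanSpace ℝ (Fin n)) c with he
  obtain ⟨r, hr, hrt⟩ := Metric.nhds_basis_closedBall.mem_iff.1
    (e.open_target.mem_nhds (e.map_source (mem_chart_source _ c)))
  set S := e.source ∩ e ⁻¹' Metric.ball (e c) r with hSdef
  have hSo : IsOpen S := e.isOpen_inter_preimage Metric.isOpen_ball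
  refine ⟨S, hSo.mem_nhds ⟨mem_chart_source _ c, Metric.mem_ball_self hr⟩, ?_⟩
  rw [withDensity_apply _ hSo.measurableSet]
  refine (setLIntegral_density_le hB (c := c) hSo.measurableSet inter_subset_left).trans_lt ?_
  have hcont : ContinuousOn (fun y => √(Matrix.of fun i j => coeff B c i j y).det)
      (Metric.closedBall (e c) r) :=
    (continuousOn_matrix_det (continuousOn_matrix fun i j =>
      (continuousOn_coeff hB c i j).mono hrt)).sqrt
  obtain ⟨C, hC⟩ := (isCompact_closedBall (e c) r).bddAbove_image hcont
  rw [nsmul_eq_mul]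
  refine ENNReal.mul_lt_top (ENNReal.natCast_lt_top _) ?_
  have himg : e '' S ⊆ Metric.closedBall (e c) r := by
    rintro _ ⟨x, hx, rfl⟩
    exact Metric.ball_subset_closedBall hx.2
  calc ∫⁻ y in e '' S, ENNReal.ofReal √(Matrix.of fun i j => coeff B c i j y).det
      ≤ ∫⁻ y in Metric.closedBall (e c) r,
          ENNReal.ofReal √(Matrix.of fun i j => coeff B c i j y).det := lintegral_mono_set himg
    _ ≤ ∫⁻ _ in Metric.closedBall (e c) r, ENNReal.ofReal C :=
        setLIntegral_mono' Metric.isClosed_closedBall.measurableSet fun y hy =>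
          ENNReal.ofReal_le_ofReal (hC ⟨y, hy, rfl⟩)
    _ = ENNReal.ofReal C * volume (Metric.closedBall (e c) r) := setLIntegral_const _ _
    _ < ⊤ := ENNReal.mul_lt_top ENNReal.ofReal_lt_top (isCompact_closedBall _ _).measure_lt_top

end Coordinates

/-! ### Measurability and continuity of the trace form -/

section PathMeasurability

variable {α ι : Type*} [MeasurableSpace α] [Fintype ι] [DecidableEq ι]

theorem measurable_matrix_inv_apply {A : α → Matrix ι ι ℝ}
    (hA : ∀ i j, Measurable fun x => A x i j) (i j : ι) :
    Measurable fun x => (A x)⁻¹ i j := by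
  have h : ∀ x, (A x)⁻¹ i j =
      ((A x).det)⁻¹ * ((A x).updateRow j (Pi.single i 1)).det := fun x => by
    rw [Matrix.inv_def, Matrix.smul_apply, Matrix.adjugate_apply, Ring.inverse_eq_inv', smul_eq_mul]
  simp only [h]
  refine (measurable_matrix_det hA).inv.mul (measurable_matrix_det fun k l => ?_)
  simp only [Matrix.updateRow_apply]
  split_ifs
  · exact measurable_const
  · exact hA k l

theorem measurable_trace_sq {A H : α → Matrix ι ι ℝ} (hA : ∀ i j, Measurable fun x => A x i j)
    (hH : ∀ i j, Measurable fun x => H x i j) :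
    Measurable fun x => ((A x)⁻¹ * H x * (A x)⁻¹ * H x).trace := by
  have hi := measurable_matrix_inv_apply hA
  have hmul : ∀ {B C : α → Matrix ι ι ℝ}, (∀ i j, Measurable fun x => B x i j) →
      (∀ i j, Measurable fun x => C x i j) → ∀ i j, Measurable fun x => (B x * C x) i j := by
    intro B C hB hC i j
    simp only [Matrix.mul_apply]
    exact Finset.measurable_fun_sum _ fun k _ => (hB i k).mul (hC k j)
  simp only [Matrix.trace, Matrix.diag_apply]
  exact Finset.measurable_fun_sum _ fun i _ => hmul (hmul (hmul hi hH) hi) hH i i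

theorem continuousOn_trace_sq {X : Type*} [TopologicalSpace X] {A H : X → Matrix ι ι ℝ} {s : Set X}
    (hA : ContinuousOn A s) (hH : ContinuousOn H s) (h : ∀ r ∈ s, (A r).det ≠ 0) :
    ContinuousOn (fun r => ((A r)⁻¹ * H r * (A r)⁻¹ * H r).trace) s := by
  have hi := continuousOn_matrix_inv hA h
  rw [continuousOn_iff_continuous_domRestrict] at hi hH ⊢
  exact (((hi.matrix_mul hH).matrix_mul hi).matrix_mul hH).matrix_trace

end PathMeasurability

/-! ### Paths of metrics: evaluation at points and the amplitude -/

section Paths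

variable {n : ℕ} {M : Type u} [TopologicalSpace M] [ChartedSpace (EuclideanSpace ℝ (Fin n)) M]
  [IsManifold (𝓡 n) ∞ M]

/-- Convergence of order zero on the compact set consisting of the single point `x`, in its own
chart. -/
theorem SmoothTendsto.tendsto_apply {ι : Type*} {F : ι → TensorField n M} {l : Filter ι}
    {B : TensorField n M} (h : SmoothTendsto F l B) (x : M) (v w : TangentSpace (𝓡 n) x) :
    Tendsto (fun a => F a x v w) l (𝓝 (B x v w)) := by
  have hx := mem_chart_source (EuclideanSpace ℝ (Fin n)) x
  have h1 : ∀ i j, Tendsto (fun a => gramIn x (F a x) i j) l (𝓝 (gramIn x (B x) i j)) := by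
    intro i j
    have h2 := (h x i j 0 {chartAt (EuclideanSpace ℝ (Fin n)) x x} isCompact_singleton
      (singleton_subset_iff.2 (mem_chart_target _ x))).tendsto_at (mem_singleton _)
    have h3 := ((continuous_eval_const (0 : Fin 0 → EuclideanSpace ℝ (Fin n))).tendsto _).comp h2
    simpa only [Function.comp_def, iteratedFDeriv_zero_apply, coeff_apply_chart _ hx] using h3
  simp only [apply_eq_dotProduct_gramIn hx, dotProduct, Matrix.mulVec]
  exact tendsto_finsetSum _ fun i _ => (tendsto_finsetSum _ fun j _ =>
    (h1 i j).mul_const _).const_mul _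

variable [MeasurableSpace M] [BorelSpace M] [CompactSpace M]

theorem SmoothMetric.continuousOn_gramIn (g : SmoothMetric n M) (c : M) (i j : Fin n) :
    ContinuousOn (fun x => gramIn c (g.inner x) i j)
      (chartAt (EuclideanSpace ℝ (Fin n)) c).source :=
  ManifoldOfMetrics.continuousOn_gramIn g.contMDiff c i j

theorem SmoothSymTensor.continuousOn_gramIn (h : SmoothSymTensor n M) (c : M) (i j : Fin n) :
    ContinuousOn (fun x => gramIn c (h.toFun x) i j)
      (chartAt (EuclideanSpace ℝ (Fin n)) c).source :=
  ManifoldOfMetrics.continuousOn_gramIn h.contMDiff c i j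

theorem SmoothMetric.posDef_gram (g : SmoothMetric n M) (x : M) : (gram (g.inner x)).PosDef :=
  ManifoldOfMetrics.posDef_gram (g.symm x) (g.pos x)

namespace MetricPath

variable {g₀ g₁ : SmoothMetric n M} (γ : MetricPath g₀ g₁)

/-- The evaluation at `x` of a path of metrics. -/
noncomputable def eval (x : M) : FiberPath (g₀.inner x) (g₁.inner x) where
  pieces := γ.pieces
  t := γ.t
  monotone := γ.monotone
  curve s := (γ.curve s).inner x
  vel i s := (γ.vel i s).toFun x
  source_eq := by rw [γ.source_eq]
  target_eq := by rw [γ.target_eq]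
  symm s _ := (γ.curve s).symm x
  posDef s _ := (γ.curve s).pos x
  hasDeriv i hi s hs v w := by
    rw [hasDerivWithinAt_iff_tendsto_slope]
    exact (γ.hasDeriv i hi s hs).tendsto_apply x v w
  continuous_vel i hi v w s hs := (γ.continuous_vel i hi s hs).tendsto_apply x v w

/-- The integrand of the length of a path, before integration over `M`. -/
noncomputable def speed (i : ℕ) (x : M) (s : ℝ) : ℝ :=
  √(trProd ((γ.curve s).inner x) ((γ.vel i s).toFun x) ((γ.vel i s).toFun x) *
    √(gram ((γ.curve s).inner x)).det)

theorem continuousOn_speed {i : ℕ} (hi : i < γ.pieces) (x : M) :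
    ContinuousOn (γ.speed i x) (Icc (γ.t i) (γ.t (i + 1))) :=
  ((continuousOn_trace_sq ((γ.eval x).continuousOn_gram_curve hi)
    ((γ.eval x).continuousOn_gram_vel hi)
    fun r _ => ((γ.curve r).posDef_gram x).det_pos.ne').mul
    (continuousOn_matrix_det ((γ.eval x).continuousOn_gram_curve hi)).sqrt).sqrt

theorem measurable_trProd (i : ℕ) (s : ℝ) : Measurable fun x =>
    trProd ((γ.curve s).inner x) ((γ.vel i s).toFun x) ((γ.vel i s).toFun x) :=
  measurable_trace_sq (measurable_gram_apply (γ.curve s).continuousOn_gramIn)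
    (measurable_gram_apply (γ.vel i s).continuousOn_gramIn)

theorem measurable_speed (i : ℕ) (s : ℝ) : Measurable fun x => γ.speed i x s :=
  ((γ.measurable_trProd i s).mul
    (measurable_matrix_det (measurable_gram_apply (γ.curve s).continuousOn_gramIn)).sqrt).sqrt

/-- The speed, extended constantly from the `i`-th interval. -/
noncomputable def speedExtend (i : ℕ) (x : M) (s : ℝ) : ℝ≥0∞ :=
  ENNReal.ofReal (γ.speed i x (projIcc (γ.t i) (γ.t (i + 1)) (γ.monotone i.le_succ) s))

/-- A function continuous in one variable and measurable in the other is jointly measurable.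
Projecting onto the interval supplies continuity on the whole line. -/
theorem measurable_speedExtend {i : ℕ} (hi : i < γ.pieces) :
    Measurable (Function.uncurry (γ.speedExtend i)) := by
  have h : Measurable (Function.uncurry fun (s : ℝ) (x : M) =>
      γ.speed i x (projIcc (γ.t i) (γ.t (i + 1)) (γ.monotone i.le_succ) s)) := by
    refine measurable_uncurry_of_continuous_of_measurable (fun x => ?_) fun s =>
      γ.measurable_speed i _
    have := continuousOn_iff_continuous_domRestrict.1 (γ.continuousOn_speed hi x)
    exact this.comp continuous_projIcc
  exact (h.comp measurable_swap).ennreal_ofReal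

theorem setLIntegral_speedExtend (i : ℕ) (x : M) :
    ∫⁻ s in Icc (γ.t i) (γ.t (i + 1)), γ.speedExtend i x s =
      ∫⁻ s in Icc (γ.t i) (γ.t (i + 1)), ENNReal.ofReal (γ.speed i x s) := by
  refine setLIntegral_congr_fun measurableSet_Icc fun s hs => ?_
  simp only [speedExtend, projIcc_of_mem _ hs]

/-- The factor `√det` inside the squared speed is the volume density, so coordinate measure replaces
the measure of the moving metric. -/
theorem lintegral_speed_sq (i : ℕ) (s : ℝ) :
    (∫⁻ x, ENNReal.ofReal (γ.speed i x s) ^ 2 ∂(coordMeasure n M)) ^ (1 / 2 : ℝ) =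
      l2Norm (γ.curve s) (γ.vel i s).toFun := by
  rw [l2Norm, vol, lintegral_withDensity_eq_lintegral_mul _
    (measurable_density (γ.curve s).continuousOn_gramIn) (γ.measurable_trProd i s).ennreal_ofReal]
  congr 1
  refine lintegral_congr fun x => ?_
  have hQ : 0 ≤ trProd ((γ.curve s).inner x) ((γ.vel i s).toFun x) ((γ.vel i s).toFun x) :=
    trProd_nonneg ((γ.curve s).symm x) ((γ.curve s).pos x) ((γ.vel i s).symm x)
  rw [Pi.mul_apply, speed, ← ENNReal.ofReal_pow (Real.sqrt_nonneg _),
    Real.sq_sqrt (by positivity), mul_comm, ENNReal.ofReal_mul (Real.sqrt_nonneg _)]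

/-- The amplitude of a path at `x`. -/
noncomputable def amplitude (x : M) : ℝ≥0∞ := (γ.eval x).amplitude

theorem amplitude_eq (x : M) : γ.amplitude x =
    ∑ i ∈ Finset.range γ.pieces, ∫⁻ s in Icc (γ.t i) (γ.t (i + 1)), γ.speedExtend i x s := by
  change ∑ i ∈ Finset.range γ.pieces, ∫⁻ s in Icc (γ.t i) (γ.t (i + 1)),
    ENNReal.ofReal (γ.speed i x s) = _
  exact Finset.sum_congr rfl fun i _ => (γ.setLIntegral_speedExtend i x).symm

theorem measurable_setLIntegral_speedExtend {i : ℕ} (hi : i < γ.pieces) :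
    Measurable fun x => ∫⁻ s in Icc (γ.t i) (γ.t (i + 1)), γ.speedExtend i x s :=
  (γ.measurable_speedExtend hi).lintegral_prod_right'

theorem measurable_amplitude : Measurable γ.amplitude := by
  rw [funext γ.amplitude_eq]
  exact Finset.measurable_fun_sum _ fun i hi =>
    γ.measurable_setLIntegral_speedExtend (Finset.mem_range.1 hi)

/-- The `L²` norm of the amplitude of a path is at most the length of the path. -/
theorem lintegral_amplitude_sq_le :
    (∫⁻ x, γ.amplitude x ^ 2 ∂(coordMeasure n M)) ^ (1 / 2 : ℝ) ≤ γ.length := by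
  classical
  -- Minkowski is used twice: over the pieces, extended by zero to a series, and then over the
  -- parameter within each piece.
  let G : ℕ → M → ℝ≥0∞ := fun i x => if i < γ.pieces then
    ∫⁻ s in Icc (γ.t i) (γ.t (i + 1)), γ.speedExtend i x s else 0
  have hG : ∀ i, Measurable (G i) := fun i => by
    by_cases hi : i < γ.pieces
    · simp only [G, if_pos hi]
      exact γ.measurable_setLIntegral_speedExtend hi
    · simp only [G, if_neg hi]
      exact measurable_const
  have hsum : ∀ x, γ.amplitude x = ∑' i, G i x := fun x => by
    rw [tsum_eq_sum (s := Finset.range γ.pieces)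
      fun i hi => if_neg (by simpa using hi), γ.amplitude_eq]
    exact Finset.sum_congr rfl fun i hi => (if_pos (Finset.mem_range.1 hi)).symm
  simp only [hsum]
  refine (lintegral_tsum_sq_le _ hG).trans ?_
  rw [tsum_eq_sum (s := Finset.range γ.pieces) fun i hi => by
    have : ¬ i < γ.pieces := by simpa using hi
    simp [G, this], length]
  refine Finset.sum_le_sum fun i hi => ?_
  have hi' := Finset.mem_range.1 hi
  simp only [G, if_pos hi']
  refine (lintegral_lintegral_sq_le _ _ (γ.measurable_speedExtend hi')).trans (le_of_eq ?_)
  refine setLIntegral_congr_fun measurableSet_Icc fun s hs => ?_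
  simp only [speedExtend, projIcc_of_mem _ hs]
  exact γ.lintegral_speed_sq i s

end MetricPath

end Paths

/-! ### Sequences with summable consecutive distances -/

theorem exists_pos_forall_lt_le {d : ℕ → ℝ} (hd : ∀ k, 0 < d k) (N : ℕ) :
    ∃ δ : ℝ, 0 < δ ∧ ∀ k < N, δ ≤ d k := by
  induction N with
  | zero => exact ⟨1, one_pos, fun k hk => absurd hk (Nat.not_lt_zero k)⟩
  | succ N ih =>
    obtain ⟨δ, hδ, h⟩ := ih
    refine ⟨min δ (d N), lt_min hδ (hd N), fun k hk => ?_⟩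
    rcases (Nat.lt_succ_iff_lt_or_eq.1 hk) with hk | rfl
    · exact (min_le_left _ _).trans (h k hk)
    · exact min_le_right _ _

/-- The limit of a sequence of positive numbers with infimum zero is zero. -/
theorem eq_zero_of_tendsto_of_forall_exists_lt {d : ℕ → ℝ} (hd : ∀ k, 0 < d k) {D : ℝ}
    (hD : Tendsto d atTop (𝓝 D)) (h : ∀ δ : ℝ, 0 < δ → ∃ k, d k < δ) : D = 0 := by
  by_contra hne
  have hpos : 0 < D := lt_of_le_of_ne (ge_of_tendsto' hD fun k => (hd k).le) (Ne.symm hne)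
  obtain ⟨N, hN⟩ := ((tendsto_order.1 hD).1 (D / 2) (half_lt_self hpos)).exists_forall_of_atTop
  -- The tail stays above `D/2` and the finitely many earlier terms above some `δ > 0`, so the
  -- infimum would be positive.
  obtain ⟨δ, hδ, hle⟩ := exists_pos_forall_lt_le hd N
  obtain ⟨k, hk⟩ := h (min δ (D / 2)) (lt_min hδ (half_pos hpos))
  rcases lt_or_ge k N with hkN | hkN
  · exact absurd (hk.trans_le (min_le_left _ _)) (not_lt.2 (hle k hkN))
  · exact absurd (hk.trans_le (min_le_right _ _)) (not_lt.2 (hN k hkN).le)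

theorem ennreal_add_sq_le (a b : ℝ≥0∞) : (a + b) ^ 2 ≤ 4 * (a ^ 2 + b ^ 2) := by
  wlog hab : a ≤ b generalizing a b
  · rw [add_comm a, add_comm (a ^ 2)]
    exact this b a (le_of_not_ge hab)
  calc (a + b) ^ 2 ≤ (b + b) ^ 2 := by gcongr
    _ = 4 * b ^ 2 := by ring
    _ ≤ _ := by gcongr; exact le_add_self

section Sequences

variable {n : ℕ} {M : Type u} [TopologicalSpace M] [ChartedSpace (EuclideanSpace ℝ (Fin n)) M]
  [IsManifold (𝓡 n) ∞ M] [MeasurableSpace M] [BorelSpace M] [CompactSpace M]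

/-- The fourth root of the determinant of a metric at `x`, in coordinates. -/
noncomputable def fourthRoot (g : SmoothMetric n M) (x : M) : ℝ := √√(gram (g.inner x)).det

theorem fourthRoot_nonneg (g : SmoothMetric n M) (x : M) : 0 ≤ fourthRoot g x :=
  Real.sqrt_nonneg _

/-- The density of a metric is positive everywhere, so its nullsets are those of coordinate measure.
-/
theorem ae_coordMeasure_of_ae_vol (g : SmoothMetric n M) {p : M → Prop}
    (h : ∀ᵐ x ∂(vol g.inner), p x) : ∀ᵐ x ∂(coordMeasure n M), p x := by
  refine (withDensity_absolutelyContinuous' (measurable_density g.continuousOn_gramIn).aemeasurable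
    (Eventually.of_forall fun x => ?_)).ae_le h
  exact (ENNReal.ofReal_pos.2 (Real.sqrt_pos.2 (g.posDef_gram x).det_pos)).ne'

theorem ae_vol_of_ae_coordMeasure (g : SmoothMetric n M) {p : M → Prop}
    (h : ∀ᵐ x ∂(coordMeasure n M), p x) : ∀ᵐ x ∂(vol g.inner), p x :=
  (withDensity_absolutelyContinuous _ _).ae_le h

theorem relDet_pos (g g' : SmoothMetric n M) (x : M) : 0 < relDet (g.inner x) (g'.inner x) := by
  rw [relDet_eq]
  exact div_pos (g'.posDef_gram x).det_pos (g.posDef_gram x).det_pos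

theorem measurable_relDet (g g' : SmoothMetric n M) :
    Measurable fun x => relDet (g.inner x) (g'.inner x) := by
  simp only [relDet_eq]
  exact (measurable_matrix_det (measurable_gram_apply g'.continuousOn_gramIn)).div
    (measurable_matrix_det (measurable_gram_apply g.continuousOn_gramIn))

theorem measurableSet_seqDeflatedSet (g : SmoothMetric n M) (gs : ℕ → SmoothMetric n M) :
    MeasurableSet (seqDeflatedSet g gs) := by
  have : seqDeflatedSet g gs =
      ⋂ m : ℕ, ⋃ k, {x | relDet (g.inner x) ((gs k).inner x) < 1 / ((m : ℝ) + 1)} := by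
    ext x
    simp only [seqDeflatedSet, mem_ofPred_eq, mem_iInter, mem_iUnion]
    refine ⟨fun h m => h _ (by positivity), fun h δ hδ => ?_⟩
    obtain ⟨m, hm⟩ := exists_nat_one_div_lt hδ
    obtain ⟨k, hk⟩ := h m
    exact ⟨k, hk.trans hm⟩
  rw [this]
  exact MeasurableSet.iInter fun m => MeasurableSet.iUnion fun k =>
    measurableSet_lt (measurable_relDet g (gs k)) measurable_const

theorem exists_relDet_ge {g : SmoothMetric n M} {gs : ℕ → SmoothMetric n M} {x : M}
    (hx : x ∉ seqDeflatedSet g gs) :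
    ∃ δ : ℝ, 0 < δ ∧ ∀ k, δ ≤ relDet (g.inner x) ((gs k).inner x) := by
  simpa only [seqDeflatedSet, mem_ofPred_eq, not_forall, not_exists, not_lt, exists_prop] using hx

theorem tendsto_det_gram {ι : Type*} {l : Filter ι} {x : M} {a : ι → TwoForm n M x}
    {B : TwoForm n M x} (h : Tendsto a l (𝓝 B)) :
    Tendsto (fun k => (gram (a k)).det) l (𝓝 (gram B).det) := by
  have h1 : Tendsto (fun k => gram (a k)) l (𝓝 (gram B)) :=
    tendsto_pi_nhds.2 fun i => tendsto_pi_nhds.2 fun j => tendsto_apply_of_tendsto h _ _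
  exact ((continuous_id.matrix_det).tendsto _).comp h1

section Summable

variable {gs : ℕ → SmoothMetric n M}

/-- Paths are chosen whose lengths exceed the distances by a summable error; Minkowski for series
then bounds the `L²` norm of the sum of the amplitudes. -/
theorem exists_paths (h : ∑' k, l2Dist (gs k) (gs (k + 1)) < ⊤) :
    ∃ γ : ∀ k, MetricPath (gs k) (gs (k + 1)),
      ∫⁻ x, (∑' k, (γ k).amplitude x) ^ 2 ∂(coordMeasure n M) < ⊤ := by
  obtain ⟨ε, hε, hsum⟩ := ENNReal.exists_pos_sum_of_countable one_ne_zero ℕ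
  have hex : ∀ k, ∃ γ : MetricPath (gs k) (gs (k + 1)),
      γ.length < l2Dist (gs k) (gs (k + 1)) + ε k := fun k => by
    refine iInf_lt_iff.1 (ENNReal.lt_add_right ?_ (by simpa using (hε k).ne'))
    exact ((ENNReal.le_tsum k).trans_lt h).ne
  choose γ hγ using hex
  refine ⟨γ, ?_⟩
  have h1 := lintegral_tsum_sq_le (coordMeasure n M) fun k => (γ k).measurable_amplitude
  have h2 : ∑' k, (∫⁻ x, (γ k).amplitude x ^ 2 ∂(coordMeasure n M)) ^ (1 / 2 : ℝ) < ⊤ := by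
    refine lt_of_le_of_lt (ENNReal.tsum_le_tsum fun k =>
      ((γ k).lintegral_amplitude_sq_le.trans (hγ k).le)) ?_
    rw [ENNReal.tsum_add]
    exact ENNReal.add_lt_top.2 ⟨h, hsum.trans ENNReal.one_lt_top⟩
  exact (ENNReal.rpow_lt_top_iff_of_pos (by norm_num)).1 (h1.trans_lt h2)

variable (γ : ∀ k, MetricPath (gs k) (gs (k + 1)))

theorem edist_fourthRoot_le (k : ℕ) (x : M) :
    edist (fourthRoot (gs k) x) (fourthRoot (gs (k + 1)) x) ≤
      ENNReal.ofReal (√n / 4) * (γ k).amplitude x := by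
  have h := ((γ k).eval x).ofReal_abs_sub_sqrt_sqrt_det_le ((γ k).eval x).right_mem
  rw [((γ k).eval x).target_eq] at h
  rwa [edist_comm, edist_dist, Real.dist_eq]

theorem ofReal_fourthRoot_le (k : ℕ) (x : M) :
    ENNReal.ofReal (fourthRoot (gs k) x) ≤ ENNReal.ofReal (fourthRoot (gs 0) x) +
      ENNReal.ofReal (√n / 4) * ∑ i ∈ Finset.range k, (γ i).amplitude x := by
  induction k with
  | zero => simp
  | succ k ih =>
    have h := edist_fourthRoot_le γ k x
    rw [edist_comm, edist_dist, Real.dist_eq] at h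
    calc ENNReal.ofReal (fourthRoot (gs (k + 1)) x)
        ≤ ENNReal.ofReal (fourthRoot (gs k) x +
            |fourthRoot (gs (k + 1)) x - fourthRoot (gs k) x|) :=
          ENNReal.ofReal_le_ofReal (sub_le_iff_le_add'.1 (le_abs_self _))
      _ ≤ ENNReal.ofReal (fourthRoot (gs k) x) +
            ENNReal.ofReal |fourthRoot (gs (k + 1)) x - fourthRoot (gs k) x| :=
          ENNReal.ofReal_add_le
      _ ≤ _ := (add_le_add ih h).trans (by rw [Finset.sum_range_succ, mul_add, add_assoc])

/-- The right side is independent of `k`: it serves both as the constant in the `θ`-estimate and as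
an envelope for dominated convergence. -/
theorem ofReal_fourthRoot_add_le (k : ℕ) (x : M) :
    ENNReal.ofReal (fourthRoot (gs k) x) + ENNReal.ofReal (√n / 4) * (γ k).amplitude x ≤
      ENNReal.ofReal (fourthRoot (gs 0) x) +
        ENNReal.ofReal (√n / 4) * ∑' i, (γ i).amplitude x := by
  calc _ ≤ ENNReal.ofReal (fourthRoot (gs 0) x) + ENNReal.ofReal (√n / 4) *
        ∑ i ∈ Finset.range (k + 1), (γ i).amplitude x := by
        rw [Finset.sum_range_succ, mul_add, ← add_assoc]
        gcongr
        exact ofReal_fourthRoot_le γ k x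
    _ ≤ _ := by
        gcongr
        exact ENNReal.sum_le_tsum _

theorem cauchySeq_fourthRoot {x : M} (hx : ∑' k, (γ k).amplitude x < ⊤) :
    CauchySeq fun k => fourthRoot (gs k) x := by
  refine cauchySeq_of_edist_le_of_tsum_ne_top _ (fun k => edist_fourthRoot_le γ k x) ?_
  rw [ENNReal.tsum_mul_left]
  exact ENNReal.mul_ne_top ENNReal.ofReal_ne_top hx.ne

/-- At points where the total amplitude is finite, the sequence is `θ`-Cauchy. -/
theorem isThetaCauchyAt_of_tsum_lt_top (g : SmoothMetric n M) {x : M}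
    (hx : ∑' k, (γ k).amplitude x < ⊤) : IsThetaCauchyAt g gs x := by
  intro ε hε
  refine thetaCauchy_of_tsum_lt_top (fun k => (gs k).symm x) (fun k => (gs k).pos x) ?_ hε
  have hdet := (g.posDef_gram x).det_pos
  have h0 : ENNReal.ofReal √(gram (g.inner x)).det ≠ 0 :=
    (ENNReal.ofReal_pos.2 (Real.sqrt_pos.2 hdet)).ne'
  set K := ENNReal.ofReal (fourthRoot (gs 0) x) +
    ENNReal.ofReal (√n / 4) * ∑' i, (γ i).amplitude x with hK
  have hKtop : K ≠ ⊤ := ENNReal.add_ne_top.2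
    ⟨ENNReal.ofReal_ne_top, ENNReal.mul_ne_top ENNReal.ofReal_ne_top hx.ne⟩
  have hterm : ∀ k, ENNReal.ofReal √(gram (g.inner x)).det *
      thetaDist (g.inner x) ((gs k).inner x) ((gs (k + 1)).inner x) ≤ K * (γ k).amplitude x := by
    intro k
    have hk : ((γ k).eval x).amplitude ≠ ⊤ := ((ENNReal.le_tsum k).trans_lt hx).ne
    calc _ ≤ ENNReal.ofReal √(gram (g.inner x)).det * ((γ k).eval x).length (g.inner x) := by
          gcongr
          exact iInf_le _ _
      _ ≤ _ := ((γ k).eval x).length_mul_sqrt_det_le hdet hk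
      _ ≤ _ := mul_le_mul_left (ofReal_fourthRoot_add_le γ k x) _
  -- An infinite sum of `θ`-distances would make the left side `⊤`, while the right side is a
  -- product of finite quantities.
  intro htop
  have h := ENNReal.tsum_le_tsum hterm
  rw [ENNReal.tsum_mul_left, ENNReal.tsum_mul_left, htop, ENNReal.mul_top h0, top_le_iff] at h
  exact ENNReal.mul_ne_top hKtop hx.ne h

theorem ae_tsum_amplitude_lt_top
    (h : ∫⁻ x, (∑' k, (γ k).amplitude x) ^ 2 ∂(coordMeasure n M) < ⊤) :
    ∀ᵐ x ∂(coordMeasure n M), ∑' k, (γ k).amplitude x < ⊤ := by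
  have hm : Measurable fun x => (∑' k, (γ k).amplitude x) ^ 2 :=
    (Measurable.tsum fun k => (γ k).measurable_amplitude).pow_const 2
  filter_upwards [ae_lt_top hm h.ne] with x hx
  by_contra hne
  rw [not_lt, top_le_iff] at hne
  simp [hne] at hx

theorem ae_isThetaCauchyAt (g : SmoothMetric n M)
    (h : ∑' k, l2Dist (gs k) (gs (k + 1)) < ⊤) :
    ∀ᵐ x ∂(coordMeasure n M), IsThetaCauchyAt g gs x := by
  obtain ⟨γ, hγ⟩ := exists_paths h
  filter_upwards [ae_tsum_amplitude_lt_top γ hγ] with x hx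
  exact isThetaCauchyAt_of_tsum_lt_top γ g hx

theorem fourthRoot_sq (g : SmoothMetric n M) (x : M) :
    fourthRoot g x ^ 2 = √(gram (g.inner x)).det :=
  Real.sq_sqrt (Real.sqrt_nonneg _)

/-- The volume forms of the metrics converge almost everywhere to that of the limit. -/
theorem ae_tendsto_density (g : SmoothMetric n M) {h : MeasurableSemimetric n M}
    (hγ : ∫⁻ x, (∑' k, (γ k).amplitude x) ^ 2 ∂(coordMeasure n M) < ⊤)
    (hX : vol g.inner (symmDiff (deflatedSet h.toFun) (seqDeflatedSet g gs)) = 0)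
    (hlim : ∀ᵐ x ∂(vol g.inner), x ∉ seqDeflatedSet g gs →
      Tendsto (fun k => (gs k).inner x) atTop (𝓝 (h.toFun x))) :
    ∀ᵐ x ∂(coordMeasure n M), Tendsto (fun k => ENNReal.ofReal √(gram ((gs k).inner x)).det) atTop
      (𝓝 (ENNReal.ofReal √(gram (h.toFun x)).det)) := by
  filter_upwards [ae_tsum_amplitude_lt_top γ hγ, ae_coordMeasure_of_ae_vol g hlim,
    ae_coordMeasure_of_ae_vol g (measure_eq_zero_iff_ae_notMem.1 hX)] with x hx h1 h2
  refine (ENNReal.continuous_ofReal.tendsto _).comp ?_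
  -- On the deflated set the limit semimetric is degenerate, so its density is zero; the fourth
  -- roots converge, and infimum zero of the determinants forces their limit to be zero. Off it the
  -- forms themselves converge.
  by_cases hxX : x ∈ seqDeflatedSet g gs
  · have hdef : x ∈ deflatedSet h.toFun := by
      by_contra hd
      exact h2 (Or.inr ⟨hxX, hd⟩)
    have hdet : (gram (h.toFun x)).det = 0 := by
      by_contra hne
      exact hdef ((isPosDef_iff_det_gramIn_ne_zero (mem_coords_source x) (h.symm x)
        (h.nonneg x)).2 hne)
    obtain ⟨L, hL⟩ := cauchySeq_tendsto_of_complete (cauchySeq_fourthRoot γ hx)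
    have hL4 : Tendsto (fun k => relDet (g.inner x) ((gs k).inner x)) atTop
        (𝓝 ((L ^ 2) ^ 2 / (gram (g.inner x)).det)) := by
      refine (((hL.pow 2).pow 2).div_const _).congr fun k => ?_
      rw [fourthRoot_sq, Real.sq_sqrt ((gs k).posDef_gram x).det_pos.le, relDet_eq]
    have h0 := eq_zero_of_tendsto_of_forall_exists_lt (fun k => relDet_pos g (gs k) x) hL4 hxX
    have hL0 : L ^ 2 = 0 := by
      simpa [(g.posDef_gram x).det_pos.ne'] using h0
    rw [hdet, Real.sqrt_zero, ← hL0]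
    exact (hL.pow 2).congr fun k => fourthRoot_sq _ _
  · exact ((Real.continuous_sqrt.tendsto _).comp (tendsto_det_gram (h1 hxX)))

/-- Dominated convergence: the densities are squares of fourth roots, whose common envelope is
square integrable. The limit density inherits the bound almost everywhere, hence finite volume. -/
theorem tendsto_vol (g : SmoothMetric n M) {h : MeasurableSemimetric n M}
    (hsum : ∑' k, l2Dist (gs k) (gs (k + 1)) < ⊤)
    (hX : vol g.inner (symmDiff (deflatedSet h.toFun) (seqDeflatedSet g gs)) = 0)
    (hlim : ∀ᵐ x ∂(vol g.inner), x ∉ seqDeflatedSet g gs →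
      Tendsto (fun k => (gs k).inner x) atTop (𝓝 (h.toFun x))) :
    HasFiniteVolume h ∧ ∀ Y : Set M,
      Tendsto (fun k => vol (gs k).inner Y) atTop (𝓝 (vol h.toFun Y)) := by
  obtain ⟨γ, hγ⟩ := exists_paths hsum
  have hconv := ae_tendsto_density γ g hγ hX hlim
  let bound : M → ℝ≥0∞ := fun x => (ENNReal.ofReal (fourthRoot (gs 0) x) +
    ENNReal.ofReal (√n / 4) * ∑' i, (γ i).amplitude x) ^ 2
  have hle : ∀ k x, ENNReal.ofReal √(gram ((gs k).inner x)).det ≤ bound x := by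
    intro k x
    rw [← fourthRoot_sq, ENNReal.ofReal_pow (fourthRoot_nonneg _ _)]
    exact pow_le_pow_left' (le_self_add.trans (ofReal_fourthRoot_add_le γ k x)) 2
  have hbound : ∫⁻ x, bound x ∂(coordMeasure n M) < ⊤ := by
    have hm : Measurable fun x => ENNReal.ofReal (fourthRoot (gs 0) x) ^ 2 :=
      ((measurable_matrix_det (measurable_gram_apply
        (gs 0).continuousOn_gramIn)).sqrt.sqrt.ennreal_ofReal).pow_const 2
    refine (lintegral_mono fun x => ennreal_add_sq_le _ _).trans_lt ?_
    simp only [mul_pow]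
    rw [lintegral_const_mul' _ _ (by norm_num), lintegral_add_left hm,
      lintegral_const_mul' _ _ (ENNReal.pow_ne_top ENNReal.ofReal_ne_top)]
    refine ENNReal.mul_lt_top (by norm_num) (ENNReal.add_lt_top.2 ⟨?_, ?_⟩)
    · refine lt_of_le_of_lt (le_of_eq (lintegral_congr fun x => ?_))
        (lintegral_density_lt_top (gs 0).continuousOn_gramIn)
      rw [← ENNReal.ofReal_pow (fourthRoot_nonneg _ _), fourthRoot_sq]
    · exact ENNReal.mul_lt_top (ENNReal.pow_lt_top ENNReal.ofReal_lt_top) hγ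
  constructor
  · rw [HasFiniteVolume, vol, withDensity_apply' _ univ, setLIntegral_univ]
    refine lt_of_le_of_lt (lintegral_mono_ae ?_) hbound
    filter_upwards [hconv] with x hx
    exact le_of_tendsto' hx fun k => hle k x
  · intro Y
    -- Coordinate measure is s-finite, so this formula holds on every set.
    simp only [vol, withDensity_apply' _ Y]
    refine tendsto_lintegral_of_dominated_convergence bound
      (fun k => measurable_density (gs k).continuousOn_gramIn)
      (fun k => Eventually.of_forall fun x => hle k x)
      ((setLIntegral_le_lintegral Y bound).trans_lt hbound).ne
      (ae_restrict_of_ae hconv)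

end Summable

/-- `ω`-convergence may be checked on one representative. -/
theorem omegaConverges_of_representative {g : SmoothMetric n M} {gs : ℕ → SmoothMetric n M}
    {h : MeasurableSemimetric n M} (hc : IsL2Cauchy gs)
    (hX : vol g.inner (symmDiff (deflatedSet h.toFun) (seqDeflatedSet g gs)) = 0)
    (hlim : ∀ᵐ x ∂(vol g.inner), x ∉ seqDeflatedSet g gs →
      Tendsto (fun k => (gs k).inner x) atTop (𝓝 (h.toFun x)))
    (hsum : ∑' k, l2Dist (gs k) (gs (k + 1)) < ⊤) : OmegaConverges g gs (toClass g h) := by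
  intro h' hh'
  obtain ⟨hs, ha⟩ : SemimetricEquiv g h' h := Quotient.exact hh'
  refine ⟨hc, measure_mono_null (symmDiff_triangle _ (deflatedSet h.toFun) _)
      (measure_union_null hs hX), ?_, hsum⟩
  filter_upwards [ha, hlim, measure_eq_zero_iff_ae_notMem.1 hs,
    measure_eq_zero_iff_ae_notMem.1 hX] with x h1 h2 h3 h4 hx
  have hxd : x ∉ deflatedSet h.toFun := fun hd => h4 (Or.inl ⟨hd, hx⟩)
  have hxd' : x ∉ deflatedSet h'.toFun := fun hd => h3 (Or.inl ⟨hd, hxd⟩)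
  rw [h1 (by simp [hxd, hxd'])]
  exact h2 hx

/-- The convergence conditions hold for each representative, so the volume bound applies to each of
them directly. -/
theorem toClass_mem_finiteVolumeClasses {g : SmoothMetric n M} {gs : ℕ → SmoothMetric n M}
    {C : SemimetricClass g} (h : OmegaConverges g gs C) : C ∈ finiteVolumeClasses g := by
  intro h' hh'
  obtain ⟨-, hX, hlim, hsum⟩ := h h' hh'
  exact (tendsto_vol g hsum hX hlim).1

/-- The index `φ m` is taken so far out that all later terms are within `ε m` of it, where the `ε m`
have finite sum. -/
theorem exists_subsequence {gs : ℕ → SmoothMetric n M} (h : IsL2Cauchy gs) :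
    ∃ φ : ℕ → ℕ, StrictMono φ ∧ IsL2Cauchy (gs ∘ φ) ∧
      ∑' k, l2Dist ((gs ∘ φ) k) ((gs ∘ φ) (k + 1)) < ⊤ := by
  obtain ⟨ε, hε, hsum⟩ := ENNReal.exists_pos_sum_of_countable one_ne_zero ℕ
  obtain ⟨φ, hφ, hd⟩ := extraction_forall_of_eventually'
    (P := fun m k => ∀ l ≥ k, l2Dist (gs k) (gs l) < ε m) fun m => by
      obtain ⟨N, hN⟩ := h (ε m) (by simpa using hε m)
      exact ⟨N, fun k hk l hl => hN k hk l (hk.trans hl)⟩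
  refine ⟨φ, hφ, fun η hη => ?_, ?_⟩
  · obtain ⟨N, hN⟩ := h η hη
    exact ⟨N, fun k hk l hl => hN _ (hk.trans (hφ.id_le k)) _ (hl.trans (hφ.id_le l))⟩
  · refine lt_of_le_of_lt (ENNReal.tsum_le_tsum fun k => ?_) (hsum.trans ENNReal.one_lt_top)
    exact (hd k _ (hφ.monotone k.le_succ)).le

/-! ### The explicit limit semimetric -/

section Limit

variable (g : SmoothMetric n M) (gs : ℕ → SmoothMetric n M)

/-- The points at which the sequence is `θ`-Cauchy and not deflated. -/
def convergenceSet : Set M := {x | IsThetaCauchyAt g gs x ∧ x ∉ seqDeflatedSet g gs}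

theorem exists_tendsto_of_mem_convergenceSet {x : M} (hx : x ∈ convergenceSet g gs) :
    ∃ B : TwoForm n M x, Tendsto (fun k => (gs k).inner x) atTop (𝓝 B) := by
  obtain ⟨δ, hδ, hlow⟩ := exists_relDet_ge hx.2
  exact exists_tendsto_of_thetaCauchy (g.posDef_gram x).det_pos (fun k => (gs k).symm x)
    (fun k => (gs k).pos x) hx.1 hδ hlow

open Classical in
/-- The pointwise limit of a sequence of metrics, extended by zero. -/
noncomputable def limitField : TensorField n M := fun x =>
  if hx : x ∈ convergenceSet g gs then (exists_tendsto_of_mem_convergenceSet g gs hx).choose else 0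

variable {g gs}

theorem tendsto_limitField {x : M} (hx : x ∈ convergenceSet g gs) :
    Tendsto (fun k => (gs k).inner x) atTop (𝓝 (limitField g gs x)) := by
  rw [limitField, dif_pos hx]
  exact (exists_tendsto_of_mem_convergenceSet g gs hx).choose_spec

theorem limitField_of_notMem {x : M} (hx : x ∉ convergenceSet g gs) : limitField g gs x = 0 :=
  dif_neg hx

theorem limitField_symm (x : M) (v w : TangentSpace (𝓡 n) x) :
    limitField g gs x v w = limitField g gs x w v := by
  by_cases hx : x ∈ convergenceSet g gs
  · refine tendsto_nhds_unique (tendsto_apply_of_tendsto (tendsto_limitField hx) v w) ?_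
    exact (tendsto_apply_of_tendsto (tendsto_limitField hx) w v).congr fun k => (gs k).symm x w v
  · simp [limitField_of_notMem hx]

theorem limitField_nonneg (x : M) (v : TangentSpace (𝓡 n) x) : 0 ≤ limitField g gs x v v := by
  by_cases hx : x ∈ convergenceSet g gs
  · refine ge_of_tendsto' (tendsto_apply_of_tendsto (tendsto_limitField hx) v v) fun k => ?_
    rcases eq_or_ne v 0 with rfl | hv
    · simp
    · exact ((gs k).pos x v hv).le
  · simp [limitField_of_notMem hx]

/-- Almost everywhere in the chart, the coefficient is the limit of the continuous coefficients cut
off to the non-deflated set. The exceptional non-Cauchy set is null in every chart. -/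
theorem nullMeasurable_coeff_limitField
    (hae : ∀ᵐ x ∂(coordMeasure n M), IsThetaCauchyAt g gs x) (c : M) (i j : Fin n) :
    NullMeasurable (coeff (limitField g gs) c i j)
      (volume.restrict (chartAt (EuclideanSpace ℝ (Fin n)) c).target) := by
  set e := chartAt (EuclideanSpace ℝ (Fin n)) c with he
  set U := e '' ((seqDeflatedSet g gs)ᶜ ∩ e.source) with hU
  have hUm : MeasurableSet U := measurableSet_chart_image
    ((measurableSet_seqDeflatedSet g gs).compl.inter e.open_source.measurableSet)
    inter_subset_right
  have hF : ∀ k, AEMeasurable (U.indicator (coeff (gs k).inner c i j))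
      (volume.restrict e.target) := fun k =>
    ((continuousOn_coeff (gs k).continuousOn_gramIn c i j).aemeasurable
      e.open_target.measurableSet).indicator hUm
  refine (aemeasurable_of_tendsto_metrizable_ae atTop hF ?_).nullMeasurable
  have hN := volume_chart_image_eq_zero (n := n) (M := M) (ae_iff.1 hae) c
  rw [ae_restrict_iff' e.open_target.measurableSet]
  filter_upwards [measure_eq_zero_iff_ae_notMem.1 hN] with y hy hyt
  have hxs : e.symm y ∈ e.source := e.map_target hyt
  have hcau : IsThetaCauchyAt g gs (e.symm y) := by
    by_contra hn
    exact hy ⟨e.symm y, ⟨hn, hxs⟩, e.right_inv hyt⟩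
  by_cases hX : e.symm y ∈ seqDeflatedSet g gs
  · have hyU : y ∉ U := by
      rintro ⟨x, hx, rfl⟩
      rw [e.left_inv hx.2] at hX
      exact hx.1 hX
    have h0 : limitField g gs (e.symm y) = 0 := limitField_of_notMem fun h => h.2 hX
    have h1 : coeff (limitField g gs) c i j y = 0 := by
      rw [coeff, ← he, h0]
      rfl
    simp only [indicator_of_notMem hyU, h1]
    exact tendsto_const_nhds
  · have hyU : y ∈ U := ⟨e.symm y, ⟨hX, hxs⟩, e.right_inv hyt⟩
    simp only [indicator_of_mem hyU]
    exact tendsto_apply_of_tendsto (tendsto_limitField (g := g) ⟨hcau, hX⟩) _ _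

/-- The pointwise limit as a measurable semimetric. -/
noncomputable def limitSemimetric
    (hae : ∀ᵐ x ∂(coordMeasure n M), IsThetaCauchyAt g gs x) : MeasurableSemimetric n M where
  toFun := limitField g gs
  symm := limitField_symm
  nonneg := limitField_nonneg
  measurable := nullMeasurable_coeff_limitField hae

/-- Off the deflated set of the sequence the lower bound on determinants survives in the limit; on
it the limit form is zero. -/
theorem mem_deflatedSet_limitField_iff {x : M} (hx : IsThetaCauchyAt g gs x) :
    x ∈ deflatedSet (limitField g gs) ↔ x ∈ seqDeflatedSet g gs := by
  constructor
  · intro hd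
    by_contra hX
    obtain ⟨δ, hδ, hlow⟩ := exists_relDet_ge hX
    have hdet := (g.posDef_gram x).det_pos
    have hlim := tendsto_det_gram (tendsto_limitField (g := g) ⟨hx, hX⟩)
    have hge : δ * (gram (g.inner x)).det ≤ (gram (limitField g gs x)).det := by
      refine ge_of_tendsto' hlim fun k => ?_
      have := hlow k
      rwa [relDet_eq, le_div_iff₀ hdet] at this
    exact hd ((isPosDef_iff_det_gramIn_ne_zero (mem_coords_source x) (limitField_symm x)
      (limitField_nonneg x)).2 ((mul_pos hδ hdet).trans_le hge).ne')
  · intro hX hpos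
    rw [limitField_of_notMem fun h => h.2 hX] at hpos
    -- In dimension zero the zero form is positive definite, but all relative determinants equal
    -- `1`, so the deflated set of the sequence is empty.
    rcases Nat.eq_zero_or_pos n with hn | hn
    · have : IsEmpty (Fin n) := by rw [hn]; infer_instance
      obtain ⟨k, hk⟩ := hX 1 one_pos
      simp [relDet, Matrix.det_isEmpty] at hk
    · have hb := (coordBasis (mem_coords_source (n := n) x)).ne_zero ⟨0, hn⟩
      simpa using hpos _ hb

end Limit

end Sequences

end ManifoldOfMetrics

/-! ### The theorem -/

theorem mainTheorem6 (n : ℕ) (M : Type*) [TopologicalSpace M] [T2Space M] [CompactSpace M]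
    [ChartedSpace (EuclideanSpace ℝ (Fin n)) M] [IsManifold (𝓡 n) ∞ M]
    [MeasurableSpace M] [BorelSpace M] (g : ManifoldOfMetrics.SmoothMetric n M) :
    (∀ gs : ℕ → ManifoldOfMetrics.SmoothMetric n M, ManifoldOfMetrics.IsL2Cauchy gs →
      ∃ φ : ℕ → ℕ, StrictMono φ ∧ ∃ h : ManifoldOfMetrics.MeasurableSemimetric n M,
        ManifoldOfMetrics.IsExplicitLimit g (gs ∘ φ) h ∧
        ManifoldOfMetrics.OmegaConverges g (gs ∘ φ) (ManifoldOfMetrics.toClass g h) ∧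
        ManifoldOfMetrics.toClass g h ∈ ManifoldOfMetrics.finiteVolumeClasses g) ∧
    (∀ gs : ℕ → ManifoldOfMetrics.SmoothMetric n M, ManifoldOfMetrics.IsL2Cauchy gs →
      ∃ C ∈ ManifoldOfMetrics.finiteVolumeClasses g,
        ManifoldOfMetrics.OmegaSubconverges g gs C) ∧
    (∀ (gs : ℕ → ManifoldOfMetrics.SmoothMetric n M) (h : ManifoldOfMetrics.MeasurableSemimetric n M),
      ManifoldOfMetrics.OmegaConverges g gs (ManifoldOfMetrics.toClass g h) →
      ∀ Y : Set M, ManifoldOfMetrics.IsLebesgueMeasurable n Y →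
        Tendsto (fun k => ManifoldOfMetrics.vol (gs k).inner Y) atTop
          (𝓝 (ManifoldOfMetrics.vol h.toFun Y))) := by
  open ManifoldOfMetrics in
  have ha : ∀ gs : ℕ → SmoothMetric n M, IsL2Cauchy gs →
      ∃ φ : ℕ → ℕ, StrictMono φ ∧ ∃ h : MeasurableSemimetric n M,
        IsExplicitLimit g (gs ∘ φ) h ∧ OmegaConverges g (gs ∘ φ) (toClass g h) ∧
        toClass g h ∈ finiteVolumeClasses g := by
    intro gs hgs
    obtain ⟨φ, hφ, hc, hsum⟩ := exists_subsequence hgs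
    have hae := ae_isThetaCauchyAt g hsum
    have homega : OmegaConverges g (gs ∘ φ) (toClass g (limitSemimetric hae)) := by
      refine omegaConverges_of_representative hc ?_ ?_ hsum
      -- At the `θ`-Cauchy points, which are almost all, the two deflated sets agree exactly.
      · rw [measure_eq_zero_iff_ae_notMem]
        filter_upwards [ae_vol_of_ae_coordMeasure g hae] with x hx hmem
        have := mem_deflatedSet_limitField_iff hx
        rcases hmem with h | h
        · exact h.2 (this.1 h.1)
        · exact h.2 (this.2 h.1)
      · filter_upwards [ae_vol_of_ae_coordMeasure g hae] with x hx hxX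
        exact tendsto_limitField (g := g) ⟨hx, hxX⟩
    refine ⟨φ, hφ, limitSemimetric hae, fun x => ⟨fun _ hX => ?_, fun hx hX => ?_, fun hx => ?_⟩,
      homega, toClass_mem_finiteVolumeClasses homega⟩
    · exact limitField_of_notMem fun h => h.2 hX
    · exact tendsto_limitField (g := g) ⟨hx, hX⟩
    · exact limitField_of_notMem fun h => hx h.1
  refine ⟨ha, fun gs hgs => ?_, fun gs h homega Y _ => ?_⟩
  · obtain ⟨φ, hφ, h, -, homega, hfin⟩ := ha gs hgs
    exact ⟨_, hfin, hgs, φ, hφ, homega⟩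
  · obtain ⟨-, hX, hlim, hsum⟩ := homega h rfl
    exact (ManifoldOfMetrics.tendsto_vol g hsum hX hlim).2 Y
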